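/- Let $\mathcal G$ be a planar graph (loops and multiple edges allowed) embedded in $\mathbb R^2$, invariant under translations by $\mathbb Z^2$, with finite quotient $\mathcal G_1=\mathcal G/\mathbb Z^2$, a graph embedded in the torus $\mathbb T^2=\mathbb R^2/\mathbb Z^2$. A flow on $\mathcal G_1$ is a real function $\omega$ on oriented edges such that $\omega(-e)=-\omega(e)$, where $-e$ is the edge $e$ with reversed orientation, and such that for every vertex $v$ the sum of $\omega(e)$ over the oriented edges $e$ starting at $v$ is $0$. Let $\mathcal F$ be the set of flows of capacity $1$ at each vertex, that is, for which at every vertex $v$ the inflow (the sum of the positive values $\omega(e)$ over the oriented edges $e$ ending at $v$) is at most $1$. A flow is a real $1$-cycle on $\mathcal G_1$, so it has a class $[\omega]\in H_1(\mathbb T^2,\mathbb R)\cong\mathbb R^2$. The unit flow polygon is $N=\{[\omega]:\omega\in\mathcal F\}\subset\mathbb R^2$. Then for every integer point $(i,j)\in N\cap\mathbb Z^2$ there is a flow $\omega\in\mathcal F$ with $[\omega]=(i,j)$ which takes only the values $0,1,-1$, and such that the oriented edges $e$ with $\omega(e)=1$ are exactly the edges of a (possibly empty) collection of pairwise vertex-disjoint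 oriented simple closed loops on $\mathcal G_1$. -/

import Mathlib

open scoped unitInterval

noncomputable section

/-- The vector of `ℝ²` given by an element of the lattice `ℤ²`. -/
def latticeVec (k : ℤ × ℤ) : ℝ × ℝ := ((k.1 : ℝ), (k.2 : ℝ))

/-- A graph embedded in the torus `ℝ²/ℤ²`, presented through the `ℤ²`-periodic graph embedded in
the plane that covers it. `V` is the set of vertices and `D` the set of oriented edges of the
quotient graph; loops and multiple edges are allowed, and so are disconnected graphs.
The periodic plane graph has the vertices `pos v + k` and the oriented edges `arc d + k` with
`k ∈ ℤ²`, so that `pos v` and `arc d` are representatives of the translation classes. -/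
structure TorusGraph (V D : Type*) where
  /-- the starting vertex of an oriented edge -/
  src : D → V
  /-- the same edge with the reverse orientation -/
  rev : D → D
  rev_rev : ∀ d, rev (rev d) = d
  rev_ne : ∀ d, rev d ≠ d
  /-- a point of the plane over each vertex -/
  pos : V → ℝ × ℝ
  /-- an arc in the plane over each oriented edge -/
  arc : D → C(I, ℝ × ℝ)
  /-- distinct vertices lie at distinct points of the torus -/
  pos_inj : ∀ u v k, pos u + latticeVec k = pos v → u = v
  arc_rev : ∀ d t, arc (rev d) t = arc d (σ t)
  /-- an arc starts at a lift of its starting vertex (and, by `arc_rev`, ends at a lift of the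
  starting vertex of its reverse) -/
  arc_zero : ∀ d, ∃ k, arc d 0 = pos (src d) + latticeVec k
  /-- the interior of an edge contains no vertex -/
  arc_ne_pos : ∀ d, ∀ t ∈ Set.Ioo (0 : I) 1, ∀ v k, arc d t ≠ pos v + latticeVec k
  /-- the interiors of the edges of the periodic plane graph are simple and pairwise disjoint -/
  arc_disjoint : ∀ d e, ∀ s ∈ Set.Ioo (0 : I) 1, ∀ t ∈ Set.Ioo (0 : I) 1, ∀ k,
    arc d s + latticeVec k = arc e t → (e = d ∧ t = s) ∨ (e = rev d ∧ t = σ s)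

namespace TorusGraph

variable {V D : Type*}

/-- The end vertex of an oriented edge. -/
def tgt (G : TorusGraph V D) (d : D) : V := G.src (G.rev d)

/-- A flow: an antisymmetric function on oriented edges with zero net outflow at each vertex. -/
def IsFlow [Fintype D] [DecidableEq V] (G : TorusGraph V D) (ω : D → ℝ) : Prop :=
  (∀ d, ω (G.rev d) = -ω d) ∧ ∀ v, ∑ d with G.src d = v, ω d = 0

/-- The inflow at `v`: the sum of the positive values of `ω` on oriented edges ending at `v`. -/
def inflow [Fintype D] [DecidableEq V] (G : TorusGraph V D) (ω : D → ℝ) (v : V) : ℝ :=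
  ∑ d with G.tgt d = v, max (ω d) 0

/-- The flows of capacity `1` at each vertex. -/
def unitFlows [Fintype D] [DecidableEq V] (G : TorusGraph V D) : Set (D → ℝ) :=
  {ω | G.IsFlow ω ∧ ∀ v, G.inflow ω v ≤ 1}

/-- The displacement in the plane along the lift of an oriented edge; it does not depend on the
lift. -/
def displacement (G : TorusGraph V D) (d : D) : ℝ × ℝ := G.arc d 1 - G.arc d 0

/-- The class in `H₁(ℝ²/ℤ², ℝ) = ℝ²` of a flow, that is, of the real 1-cycle `ω`: its periods
against the closed forms `dx` and `dy`. Every unoriented edge occurs in the sum with both of its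
orientations, which contribute the same, whence the factor `1/2`. -/
def homologyClass [Fintype D] (G : TorusGraph V D) (ω : D → ℝ) : ℝ × ℝ :=
  (1 / 2 : ℝ) • ∑ d, ω d • G.displacement d

/-- The unit flow polygon: the set of classes in `H₁(ℝ²/ℤ², ℝ) = ℝ²` of the flows of
capacity `1`. (The graph has no 2-cells, so a flow is the same as a class in `H₁` of the graph.) -/
def unitFlowPolygon [Fintype D] [DecidableEq V] (G : TorusGraph V D) : Set (ℝ × ℝ) :=
  G.homologyClass '' G.unitFlows

/-- An oriented closed loop on the torus graph: a nonempty cyclic sequence of oriented edges, each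
ending where the next one starts, which visits no vertex twice. -/
def IsLoop (G : TorusGraph V D) (c : Cycle D) : Prop :=
  c ≠ Cycle.nil ∧ c.Chain (fun d e => G.tgt d = G.src e) ∧ (c.map G.src).Nodup

/-- Two loops without a common vertex. -/
def VertexDisjoint (G : TorusGraph V D) (c c' : Cycle D) : Prop :=
  ∀ d ∈ c, ∀ d' ∈ c', G.src d ≠ G.src d'

end TorusGraph

end

/-! The proof is planar duality. A flow is the discrete differential of a height function on the
faces of the periodic graph, its homology class is given by the periods of the heights, and the
capacity at a vertex bounds the variation of the heights around that vertex. Rounding the heights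
then rounds the flow.

The faces used are the unit squares of a fine grid, not those of the embedding. `exists_gridModel`
replaces vertices by disjoint connected sets of grid points (blobs) and edges by single grid edges
between them; loops of class zero are discarded. A flow on the graph extends into the blobs along
spanning trees. The extended flow has a height function `h`, and because the routing follows a tree,
the heights touching a blob differ by at most half of the flux through its boundary, that is, by at
most the inflow at the vertex (`GridTree.exists_routing`, `GridModel.exists_height`).

Let `(i, j) = k (p, q)` with `p`, `q` coprime and `(i, j) ≠ 0`. For `m = 0, ..., k - 1` the rounded
height `⌊(h - m) / k⌋` has periods `k` times smaller than those of `h`, so its flow has class `(p,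
q)`. Around a vertex `h` varies by at most 1, so it crosses at most one integer level there: the
rounded flows take values in `{0, 1, -1}`, and the residue of that level mod `k` determines `m`,
which makes the `k` supports vertex-disjoint. The level itself is a potential `T` on the vertices,
and it forces every cycle in the supports to be parallel to `(p, q)` (`exists_rounding`).

Each rounded flow therefore contains a loop of class `n (p, q)` with `n > 0`. Rounding the unit flow
of this loop with `n` in place of `k` gives an integral flow on the loop of class `(p, q)`, hence `n
= 1` (`exists_primitive_loop`). The sum of these `k` loops, one from each rounded flow, is the
required flow. -/

namespace SquareGrid

/-! ### Height functions on the square grid -/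

/-- The four unit steps of the square grid, in counterclockwise order. -/
def step : Fin 4 → ℤ × ℤ := ![(1, 0), (0, 1), (-1, 0), (0, -1)]

/-- The unit squares around a grid point, each named by its lower left corner. The square
`x + corner q` lies to the left of the edge from `x` to `x + step q`. -/
def corner : Fin 4 → ℤ × ℤ := ![(0, 0), (-1, 0), (-1, -1), (0, -1)]

/-- The flow of a height function `h` on squares along the edge from `x` to `x + step q`. -/
noncomputable def jump (h : ℤ × ℤ → ℝ) (x : ℤ × ℤ) (q : Fin 4) : ℝ :=
  h (x + corner q) - h (x + corner (q + 3))

lemma step_rev (q : Fin 4) : step q + step (q + 2) = 0 := by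
  revert q; decide

lemma step_ne_zero (q : Fin 4) : step q ≠ 0 := by
  revert q; decide

lemma step_injective : Function.Injective step := by
  intro a b; revert a b; decide

lemma dir_rev_rev (q : Fin 4) : q + 2 + 2 = q := by
  revert q; decide

lemma add_step_rev (x : ℤ × ℤ) (q : Fin 4) : x + step q + step (q + 2) = x := by
  rw [add_assoc, step_rev, add_zero]

lemma step_add_corner (q : Fin 4) : step q + corner (q + 2) = corner (q + 3) := by
  revert q; decide

lemma step_add_corner' (q : Fin 4) : step q + corner (q + 2 + 3) = corner q := by
  revert q; decide

lemma jump_rev (h : ℤ × ℤ → ℝ) (x : ℤ × ℤ) (q : Fin 4) :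
    jump h (x + step q) (q + 2) = -jump h x q := by
  simp only [jump, add_assoc x]
  rw [step_add_corner, step_add_corner']
  ring

lemma sum_jump (h : ℤ × ℤ → ℝ) (x : ℤ × ℤ) : ∑ q, jump h x q = 0 := by
  rw [Fin.sum_univ_four]
  simp only [jump]
  have e1 : (1 : Fin 4) + 3 = 0 := by decide
  have e2 : (2 : Fin 4) + 3 = 1 := by decide
  have e3 : (3 : Fin 4) + 3 = 2 := by decide
  rw [e1, e2, e3, zero_add]
  ring

lemma exists_antidifference (g : ℤ → ℝ) : ∃ G : ℤ → ℝ, ∀ n, G (n + 1) = G n + g n := by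
  refine ⟨fun n => match n with
    | Int.ofNat k => ∑ i ∈ Finset.range k, g i
    | Int.negSucc k => -∑ i ∈ Finset.range (k + 1), g (Int.negSucc i), ?_⟩
  intro n
  match n with
  | Int.ofNat k =>
    change ∑ i ∈ Finset.range (k + 1), g i = _
    rw [Finset.sum_range_succ]; rfl
  | Int.negSucc 0 =>
    change ∑ i ∈ Finset.range 0, g i = _
    simp
  | Int.negSucc (k + 1) =>
    change -∑ i ∈ Finset.range (k + 1), g (Int.negSucc i) = _
    dsimp only
    rw [Finset.sum_range_succ _ (k + 1)]
    ring

/-- The discrete Poincaré lemma: a divergence-free flow on the square grid has a height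
function. -/
lemma exists_height (f : ℤ × ℤ → Fin 4 → ℝ)
    (hrev : ∀ x q, f (x + step q) (q + 2) = -f x q) (hdiv : ∀ x, ∑ q, f x q = 0) :
    ∃ h, ∀ x q, jump h x q = f x q := by
  have h2 : ∀ a b, f (a, b) 2 = -f (a - 1, b) 0 := by
    intro a b
    have := hrev (a - 1, b) 0
    simpa [step] using this
  have h3 : ∀ a b, f (a, b) 3 = -f (a, b - 1) 1 := by
    intro a b
    have := hrev (a, b - 1) 1
    have e : (1 : Fin 4) + 2 = 3 := by decide
    rw [e] at this
    simpa [step] using this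
  have hd : ∀ a b, f (a, b) 0 + f (a, b) 1 - f (a - 1, b) 0 - f (a, b - 1) 1 = 0 := by
    intro a b
    have := hdiv (a, b)
    rw [Fin.sum_univ_four, h2, h3] at this
    linarith
  -- `A` integrates along row 0 and `B a` along column `a`. Agreement with the horizontal edges is
  -- then built in everywhere, agreement with the vertical edges only in row 0; zero divergence
  -- carries it from row to row.
  obtain ⟨A, hA⟩ := exists_antidifference fun a => -f (a + 1, 0) 1
  choose B hB using fun a => exists_antidifference fun b => f (a, b + 1) 0
  let h : ℤ × ℤ → ℝ := fun s => A s.1 + (B s.1 s.2 - B s.1 0)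
  have hx : ∀ a b, h (a, b) - h (a, b - 1) = f (a, b) 0 := by
    intro a b
    have := hB a (b - 1)
    simp only [sub_add_cancel] at this
    simp only [h]
    linarith
  have hy0 : ∀ a, h (a - 1, 0) - h (a, 0) = f (a, 0) 1 := by
    intro a
    have := hA (a - 1)
    simp only [sub_add_cancel] at this
    simp only [h]
    linarith
  have hy : ∀ a b, h (a - 1, b) - h (a, b) = f (a, b) 1 := by
    intro a b
    induction b using Int.induction_on with
    | zero => exact hy0 a
    | succ n ih =>
      have e1 := hx a (n + 1)
      have e2 := hx (a - 1) (n + 1)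
      have e3 := hd a (n + 1)
      simp only [add_sub_cancel_right] at e1 e2 e3
      linarith
    | pred n ih =>
      have e1 := hx a (-n)
      have e2 := hx (a - 1) (-n)
      have e3 := hd a (-n)
      linarith
  refine ⟨h, ?_⟩
  have j0 : ∀ x, jump h x 0 = f x 0 := by
    rintro ⟨a, b⟩
    have := hx a b
    simpa [jump, corner, sub_eq_add_neg] using this
  have j1 : ∀ x, jump h x 1 = f x 1 := by
    rintro ⟨a, b⟩
    have := hy a b
    have e : (1 : Fin 4) + 3 = 0 := by decide
    rw [jump, e]
    simpa [corner, sub_eq_add_neg] using this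
  intro x q
  have key : ∀ p : Fin 4, (∀ y, jump h y p = f y p) → jump h x (p + 2) = f x (p + 2) := by
    intro p hp
    have e : x + step (p + 2) + step p = x := by
      have := add_step_rev x (p + 2)
      rwa [dir_rev_rev] at this
    have e1 := jump_rev h (x + step (p + 2)) p
    have e2 := hrev (x + step (p + 2)) p
    rw [e] at e1 e2
    rw [e1, e2, hp]
  fin_cases q
  · exact j0 x
  · exact j1 x
  · exact key 0 j0
  · exact key 1 j1

/-- Any two squares are joined by a chain of adjacent squares. This is the uniqueness of heights up
to a constant, from which their periods arise. -/
lemma eq_of_jump_eq_zero {h : ℤ × ℤ → ℝ} (h0 : ∀ x q, jump h x q = 0) (s t : ℤ × ℤ) :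
    h s = h t := by
  have hx : ∀ a b, h (a, b) = h (a, b - 1) := by
    intro a b
    have := h0 (a, b) 0
    simp [jump, corner] at this
    rw [sub_eq_add_neg b 1]; linarith
  have hy : ∀ a b, h (a - 1, b) = h (a, b) := by
    intro a b
    have := h0 (a, b) 1
    have e : (1 : Fin 4) + 3 = 0 := by decide
    rw [jump, e] at this
    simp [corner] at this
    rw [sub_eq_add_neg a 1]; linarith
  have hx' : ∀ a b, h (a, b) = h (a, 0) := by
    intro a b
    induction b using Int.induction_on with
    | zero => rfl
    | succ n ih => rw [hx, add_sub_cancel_right, ih]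
    | pred n ih => rw [← hx, ih]
  have hy' : ∀ a, h (a, 0) = h (0, 0) := by
    intro a
    induction a using Int.induction_on with
    | zero => rfl
    | succ n ih => rw [← hy, add_sub_cancel_right, ih]
    | pred n ih => rw [hy, ih]
  obtain ⟨a, b⟩ := s
  obtain ⟨c, d⟩ := t
  rw [hx' a, hx' c, hy' a, hy' c]

/-- Heights of a periodic flow are periodic up to a constant. -/
lemma exists_period {h : ℤ × ℤ → ℝ} {v : ℤ × ℤ}
    (hv : ∀ x q, jump h (x + v) q = jump h x q) : ∃ l, ∀ s, h (s + v) = h s + l := by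
  refine ⟨h (0 + v) - h 0, fun s => ?_⟩
  have := eq_of_jump_eq_zero (h := fun s => h (s + v) - h s) (fun x q => by
    have := hv x q
    simp only [jump] at this ⊢
    simp only [add_right_comm x _ v] at this ⊢
    linarith) s 0
  linarith

lemma period_smul {h : ℤ × ℤ → ℝ} {v : ℤ × ℤ} {l : ℝ} (hv : ∀ s, h (s + v) = h s + l) (n : ℤ)
    (s : ℤ × ℤ) : h (s + n • v) = h s + n * l := by
  induction n using Int.induction_on with
  | zero => simp
  | succ n ih =>
    rw [add_smul, one_smul, ← add_assoc, hv, ih]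
    push_cast; ring
  | pred n ih =>
    have := hv (s + (-(n : ℤ) - 1) • v)
    rw [sub_smul, one_smul, add_assoc, sub_add_cancel, ih] at this
    rw [sub_smul, one_smul]
    push_cast at this ⊢
    linarith

/-! ### Boundary flux and the range of heights around a set -/

open Classical in
/-- The total absolute flow through the edges that leave `B`. -/
noncomputable def boundaryFlux (f : ℤ × ℤ → Fin 4 → ℝ) (B : Finset (ℤ × ℤ)) : ℝ :=
  ∑ x ∈ B, ∑ q, if x + step q ∈ B then 0 else |f x q|

/-- The heights of any two squares that touch `B` differ by at most half of the boundary flux. -/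
def RangeBound (h : ℤ × ℤ → ℝ) (B : Finset (ℤ × ℤ)) : Prop :=
  ∀ x ∈ B, ∀ q, ∀ y ∈ B, ∀ p,
    |h (x + corner q) - h (y + corner p)| ≤ boundaryFlux (jump h) B / 2

lemma boundaryFlux_singleton (f : ℤ × ℤ → Fin 4 → ℝ) (y : ℤ × ℤ) :
    boundaryFlux f {y} = ∑ q, |f y q| := by
  classical
  simp [boundaryFlux, step_ne_zero]

/-- The four heights around a point form a closed cycle. Between any two of them there are two ways
around, and the shorter one has at most half of the total variation. -/
lemma rangeBound_singleton (h : ℤ × ℤ → ℝ) (y : ℤ × ℤ) : RangeBound h {y} := by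
  intro x hx q z hz p
  rw [Finset.mem_singleton] at hx hz
  subst hx; subst hz
  rw [boundaryFlux_singleton, Fin.sum_univ_four]
  have e1 : (1 : Fin 4) + 3 = 0 := by decide
  have e2 : (2 : Fin 4) + 3 = 1 := by decide
  have e3 : (3 : Fin 4) + 3 = 2 := by decide
  simp only [jump, e1, e2, e3, zero_add]
  generalize hg : (fun q => h (z + corner q)) = g
  have hg' : ∀ q, h (z + corner q) = g q := fun q => by rw [← hg]
  simp only [hg']
  have a0 := abs_le.1 (le_refl |g 0 - g 3|)
  have a1 := abs_le.1 (le_refl |g 1 - g 0|)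
  have a2 := abs_le.1 (le_refl |g 2 - g 1|)
  have a3 := abs_le.1 (le_refl |g 3 - g 2|)
  fin_cases q <;> fin_cases p <;> (refine abs_le.2 ⟨?_, ?_⟩) <;> dsimp <;> linarith

/-- Among the edges joining the new point to `B` only the one from `x` carries flow. It stops being
a boundary edge, and it was counted once for `B` and once for the new point. -/
lemma boundaryFlux_insert {f : ℤ × ℤ → Fin 4 → ℝ} {B : Finset (ℤ × ℤ)} {x : ℤ × ℤ} {q₀ : Fin 4}
    (hrev : ∀ x q, f (x + step q) (q + 2) = -f x q)
    (hx : x ∈ B) (hy : x + step q₀ ∉ B)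
    (h0 : ∀ z ∈ B, ∀ q, z + step q = x + step q₀ → z ≠ x → f z q = 0) :
    boundaryFlux f (insert (x + step q₀) B) + 2 * |f x q₀|
      = boundaryFlux f B + boundaryFlux f {x + step q₀} := by
  classical
  set y := x + step q₀ with hydef
  have e1 : boundaryFlux f B = (∑ z ∈ B, ∑ q, if z + step q ∈ insert y B then 0 else |f z q|)
      + ∑ z ∈ B, ∑ q, if z + step q = y then |f z q| else 0 := by
    rw [boundaryFlux, ← Finset.sum_add_distrib]
    refine Finset.sum_congr rfl fun z hz => ?_
    rw [← Finset.sum_add_distrib]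
    refine Finset.sum_congr rfl fun q _ => ?_
    by_cases h1 : z + step q = y
    · simp [h1, hy]
    · by_cases h2 : z + step q ∈ B <;> simp [h1, h2]
  have e2 : ∑ z ∈ B, ∑ q, (if z + step q = y then |f z q| else 0) = |f x q₀| := by
    rw [Finset.sum_eq_single_of_mem x hx, Finset.sum_eq_single_of_mem q₀ (Finset.mem_univ _)]
    · simp [hydef]
    · intro q _ hq
      rw [if_neg]
      intro h
      exact hq (step_injective (add_left_cancel h))
    · intro z hz hzx
      refine Finset.sum_eq_zero fun q _ => ?_
      split_ifs with h
      · rw [h0 z hz q h hzx, abs_zero]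
      · rfl
  have e3 : boundaryFlux f {y} = (∑ q, if y + step q ∈ insert y B then 0 else |f y q|)
      + ∑ q, if y + step q ∈ B then |f y q| else 0 := by
    rw [boundaryFlux_singleton, ← Finset.sum_add_distrib]
    refine Finset.sum_congr rfl fun q _ => ?_
    by_cases h2 : y + step q ∈ B <;> simp [h2, step_ne_zero]
  have e4 : ∑ q, (if y + step q ∈ B then |f y q| else 0) = |f x q₀| := by
    rw [Finset.sum_eq_single_of_mem (q₀ + 2) (Finset.mem_univ _)]
    · rw [hydef, add_step_rev, if_pos hx, hrev, abs_neg]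
    · intro q _ hq
      split_ifs with h
      · have h5 := hrev y q
        rw [h0 _ h (q + 2) (add_step_rev y q)] at h5
        · rw [show f y q = 0 by linarith, abs_zero]
        · intro h6
          apply hq
          apply step_injective
          have : y + step (q₀ + 2) = x := by rw [hydef, add_step_rev]
          exact add_left_cancel (h6.trans this.symm)
      · rfl
  have e5 : boundaryFlux f (insert y B)
      = (∑ q, if y + step q ∈ insert y B then 0 else |f y q|)
        + ∑ z ∈ B, ∑ q, if z + step q ∈ insert y B then 0 else |f z q| := by
    rw [boundaryFlux, Finset.sum_insert hy]
  rw [e5, e1, e2, e3, e4]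
  ring

/-- The heights around `B` and those around the new point both include the heights `a`, `b` on the
two sides of the joining edge. Two ranges that share a pair at distance `|a - b|` have a union of
length at most the sum of their lengths minus `|a - b|`, which is exactly the loss in
`boundaryFlux_insert`. -/
lemma RangeBound.insert {h : ℤ × ℤ → ℝ} {B : Finset (ℤ × ℤ)} {x : ℤ × ℤ} {q₀ : Fin 4}
    (hB : RangeBound h B) (hx : x ∈ B) (hy : x + step q₀ ∉ B)
    (h0 : ∀ z ∈ B, ∀ q, z + step q = x + step q₀ → z ≠ x → jump h z q = 0) :
    RangeBound h (insert (x + step q₀) B) := by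
  have hF := boundaryFlux_insert (jump_rev h) hx hy h0
  have hY := rangeBound_singleton h (x + step q₀)
  set y := x + step q₀ with hydef
  set a := h (x + corner q₀) with ha
  set b := h (x + corner (q₀ + 3)) with hb
  have ha' : h (y + corner (q₀ + 2 + 3)) = a := by
    rw [hydef, add_assoc, step_add_corner']
  have hb' : h (y + corner (q₀ + 2)) = b := by
    rw [hydef, add_assoc, step_add_corner]
  have hj : jump h x q₀ = a - b := rfl
  rw [hj] at hF
  have my : y ∈ ({y} : Finset (ℤ × ℤ)) := Finset.mem_singleton_self y
  have bB : ∀ z ∈ B, ∀ q, |h (z + corner q) - a| ≤ boundaryFlux (jump h) B / 2 ∧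
      |h (z + corner q) - b| ≤ boundaryFlux (jump h) B / 2 :=
    fun z hz q => ⟨hB z hz q x hx q₀, hB z hz q x hx (q₀ + 3)⟩
  have bY : ∀ q, |h (y + corner q) - a| ≤ boundaryFlux (jump h) {y} / 2 ∧
      |h (y + corner q) - b| ≤ boundaryFlux (jump h) {y} / 2 := by
    intro q
    have i1 := hY y my q y my (q₀ + 2 + 3)
    have i2 := hY y my q y my (q₀ + 2)
    rw [ha'] at i1
    rw [hb'] at i2
    exact ⟨i1, i2⟩
  have cB := hB x hx q₀ x hx (q₀ + 3)
  rw [← ha, ← hb] at cB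
  have cY := (bY (q₀ + 2)).1
  rw [hb', abs_sub_comm] at cY
  have mix : ∀ z ∈ B, ∀ q p, |h (z + corner q) - h (y + corner p)|
      ≤ boundaryFlux (jump h) (Insert.insert y B) / 2 := by
    intro z hz q p
    obtain ⟨u1, u2⟩ := bB z hz q
    obtain ⟨u3, u4⟩ := bY p
    rw [abs_le] at u1 u2 u3 u4 ⊢
    rcases abs_cases (a - b) with ⟨h1, -⟩ | ⟨h1, -⟩ <;> rw [h1] at hF <;> constructor <;> linarith
  intro z hz q w hw p
  rcases Finset.mem_insert.1 hz with rfl | hz <;> rcases Finset.mem_insert.1 hw with rfl | hw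
  · have := hY y my q y my p
    linarith
  · rw [abs_sub_comm]
    exact mix w hw p q
  · exact mix z hz q p
  · have := hB z hz q w hw p
    linarith

/-! ### Routing along spanning trees -/

/-- Finite connected sets of grid points, built by adding one neighbour at a time. -/
inductive GridTree : Finset (ℤ × ℤ) → Prop
  | single (x) : GridTree {x}
  | insert {B} {x} {q} (hB : GridTree B) (hx : x ∈ B) (hy : x + step q ∉ B) :
      GridTree (insert (x + step q) B)

/-- In a connected set every zero-sum demand is met by a flow along a spanning tree, and such a
flow controls the heights around the set. -/
lemma GridTree.exists_routing {B : Finset (ℤ × ℤ)} (hB : GridTree B) :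
    ∀ b : ℤ × ℤ → ℝ, ∑ x ∈ B, b x = 0 → ∃ F : ℤ × ℤ → Fin 4 → ℝ,
      (∀ x q, F (x + step q) (q + 2) = -F x q) ∧
      (∀ x q, F x q ≠ 0 → x ∈ B ∧ x + step q ∈ B) ∧
      (∀ x ∈ B, ∑ q, F x q = b x) ∧
      ∀ h, (∀ x ∈ B, ∀ q, x + step q ∈ B → jump h x q = F x q) → RangeBound h B := by
  classical
  induction hB with
  | single x =>
    intro b hb
    refine ⟨fun _ _ => 0, by simp, by simp, ?_, fun h _ => rangeBound_singleton h x⟩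
    intro y hy
    rw [Finset.mem_singleton] at hy
    subst hy
    simpa using hb.symm
  | @insert B x q₀ hB hx hy ih =>
    intro b hb
    set y := x + step q₀ with hydef
    rw [Finset.sum_insert hy] at hb
    have hyx : y ≠ x := fun h => hy (h ▸ hx)
    -- The demand of the leaf `y` is handed over to its neighbour `x`; `E` below carries it along
    -- the one new edge. All other edges between `y` and `B` stay empty, as `RangeBound.insert`
    -- requires.
    obtain ⟨F, F1, F2, F3, F4⟩ := ih (fun z => b z + if z = x then b y else 0) (by
      rw [Finset.sum_add_distrib, Finset.sum_ite_eq' B x, if_pos hx]; linarith)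
    have hy2 : y + step (q₀ + 2) = x := add_step_rev x q₀
    let E : ℤ × ℤ → Fin 4 → ℝ := fun z q =>
      (if z = y ∧ q = q₀ + 2 then b y else 0) - if z = x ∧ q = q₀ then b y else 0
    have hE1 : ∀ z q, E (z + step q) (q + 2) = -E z q := by
      intro z q
      have i1 : (z + step q = y ∧ q + 2 = q₀ + 2) ↔ (z = x ∧ q = q₀) := by
        constructor
        · rintro ⟨h1, h2⟩
          have h2 := add_right_cancel h2
          subst h2
          exact ⟨add_right_cancel h1, rfl⟩
        · rintro ⟨rfl, rfl⟩; exact ⟨rfl, rfl⟩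
      have i2 : (z + step q = x ∧ q + 2 = q₀) ↔ (z = y ∧ q = q₀ + 2) := by
        constructor
        · rintro ⟨h1, h2⟩
          subst h2
          refine ⟨?_, (dir_rev_rev q).symm⟩
          rw [hydef, ← h1, add_step_rev]
        · rintro ⟨h1, rfl⟩
          exact ⟨by rw [h1, hy2], dir_rev_rev _⟩
      simp only [E, i1, i2]
      ring
    have hE2 : ∀ z q, E z q ≠ 0 → (z = y ∧ q = q₀ + 2) ∨ (z = x ∧ q = q₀) := by
      intro z q h
      by_contra! hc
      apply h
      simp only [E]
      rw [if_neg (fun h' => hc.1 h'.1 h'.2), if_neg (fun h' => hc.2 h'.1 h'.2), sub_zero]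
    have hE3 : ∀ z, ∑ q, E z q = (if z = y then b y else 0) - if z = x then b y else 0 := by
      intro z
      simp only [E, Finset.sum_sub_distrib, ite_and]
      congr 1 <;> split_ifs <;> simp
    have hFy : ∀ z q, F z q ≠ 0 → z ≠ y ∧ z + step q ≠ y := fun z q h =>
      ⟨fun h' => hy (h' ▸ (F2 z q h).1), fun h' => hy (h' ▸ (F2 z q h).2)⟩
    refine ⟨fun z q => F z q + E z q, ?_, ?_, ?_, ?_⟩
    · intro z q
      beta_reduce
      rw [F1, hE1]; ring
    · intro z q h
      by_cases h1 : F z q = 0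
      · beta_reduce at h
        rw [h1, zero_add] at h
        rcases hE2 z q h with ⟨rfl, rfl⟩ | ⟨rfl, rfl⟩
        · rw [hy2]
          exact ⟨Finset.mem_insert_self _ _, Finset.mem_insert_of_mem hx⟩
        · exact ⟨Finset.mem_insert_of_mem hx, Finset.mem_insert_self _ _⟩
      · exact ⟨Finset.mem_insert_of_mem (F2 z q h1).1, Finset.mem_insert_of_mem (F2 z q h1).2⟩
    · intro z hz
      rw [Finset.sum_add_distrib, hE3]
      rcases Finset.mem_insert.1 hz with hz | hz
      · rw [hz]
        have : ∑ q, F y q = 0 := by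
          refine Finset.sum_eq_zero fun q _ => ?_
          by_contra h
          exact (hFy _ _ h).1 rfl
        rw [this, if_pos rfl, if_neg hyx]; ring
      · rw [F3 z hz, if_neg (fun h : z = y => hy (h ▸ hz))]
        ring
    · intro h hh
      refine RangeBound.insert (F4 h fun z hz q hzq => ?_) hx hy fun z hz q hzq hzx => ?_
      · rw [hh z (Finset.mem_insert_of_mem hz) q (Finset.mem_insert_of_mem hzq)]
        have : E z q = 0 := by
          by_contra hne
          rcases hE2 z q hne with ⟨rfl, rfl⟩ | ⟨rfl, rfl⟩
          · exact hy hz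
          · exact hy hzq
        simp only [this, add_zero]
      · rw [hh z (Finset.mem_insert_of_mem hz) q
          (by rw [hzq]; exact Finset.mem_insert_self _ _)]
        have e1 : F z q = 0 := by
          by_contra hne
          exact (hFy z q hne).2 hzq
        have e2 : E z q = 0 := by
          by_contra hne
          rcases hE2 z q hne with ⟨rfl, rfl⟩ | ⟨rfl, rfl⟩
          · exact hy hz
          · exact hzx rfl
        simp only [e1, e2, add_zero]

/-- A finite set in which all points can be reached from one of them is a `GridTree`. -/
lemma GridTree.of_reachable {B : Finset (ℤ × ℤ)} {x₀ : ℤ × ℤ} (hx₀ : x₀ ∈ B)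
    (hB : ∀ x ∈ B, Relation.ReflTransGen (fun y z => z ∈ B ∧ ∃ q, z = y + step q) x₀ x) :
    GridTree B := by
  classical
  -- A tree of maximal size through `x₀`: any walk leaving it within `B` would enlarge it.
  obtain ⟨T, hT, hmax⟩ := (B.powerset.filter fun T => GridTree T ∧ x₀ ∈ T).exists_max_image
    Finset.card ⟨{x₀}, by simp [hx₀, GridTree.single]⟩
  simp only [Finset.mem_filter, Finset.mem_powerset] at hT hmax
  obtain ⟨hTB, hT1, hT2⟩ := hT
  have : ∀ x ∈ B, x ∈ T := by
    intro x hx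
    have h := hB x hx
    clear hx
    induction h with
    | refl => exact hT2
    | @tail y z _ hyz ih =>
      by_contra hz
      obtain ⟨hzB, q, rfl⟩ := hyz
      have := hmax (Insert.insert (y + step q) T) ⟨Finset.insert_subset hzB hTB,
        GridTree.insert hT1 ih hz, Finset.mem_insert_of_mem hT2⟩
      rw [Finset.card_insert_of_notMem hz] at this
      omega
  rwa [Finset.Subset.antisymm this hTB]

end SquareGrid

/-! ### Flows on a torus graph -/

namespace TorusGraph

open SquareGrid

variable {V D : Type*}

lemma sum_comp_rev [Fintype D] (G : TorusGraph V D) {M : Type*} [AddCommMonoid M] (g : D → M) :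
    ∑ d, g (G.rev d) = ∑ d, g d :=
  Equiv.sum_comp (Function.Involutive.toPerm G.rev G.rev_rev) g

lemma tgt_rev (G : TorusGraph V D) (d : D) : G.tgt (G.rev d) = G.src d := by
  rw [tgt, G.rev_rev]

lemma IsFlow.sum_smul_src [Fintype V] [Fintype D] [DecidableEq V] {G : TorusGraph V D}
    {ω : D → ℝ} (hω : G.IsFlow ω) {M : Type*} [AddCommGroup M] [Module ℝ M] (φ : V → M) :
    ∑ d, ω d • φ (G.src d) = 0 := by
  rw [← Finset.sum_fiberwise Finset.univ G.src]
  refine Finset.sum_eq_zero fun v _ => ?_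
  rw [← zero_smul ℝ (φ v), ← hω.2 v, Finset.sum_smul]
  refine Finset.sum_congr rfl fun d hd => ?_
  rw [(Finset.mem_filter.1 hd).2]

/-- A flow pairs to zero with every gradient. -/
lemma IsFlow.sum_smul_sub [Fintype V] [Fintype D] [DecidableEq V] {G : TorusGraph V D}
    {ω : D → ℝ} (hω : G.IsFlow ω) {M : Type*} [AddCommGroup M] [Module ℝ M] (φ : V → M) :
    ∑ d, ω d • (φ (G.tgt d) - φ (G.src d)) = 0 := by
  simp only [smul_sub, Finset.sum_sub_distrib]
  rw [hω.sum_smul_src, sub_zero, ← G.sum_comp_rev]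
  simp only [tgt_rev, hω.1, neg_smul, Finset.sum_neg_distrib, hω.sum_smul_src, neg_zero]

/-- Conservation at `v`: the positive and the negative parts of the outgoing values have equal sums.
-/
lemma IsFlow.inflow_eq [Fintype D] [DecidableEq V] {G : TorusGraph V D} {ω : D → ℝ}
    (hω : G.IsFlow ω) (v : V) : G.inflow ω v = ∑ d with G.src d = v, max (ω d) 0 := by
  have h1 : G.inflow ω v = ∑ d with G.src d = v, max (-ω d) 0 := by
    rw [inflow, Finset.sum_filter, Finset.sum_filter, ← G.sum_comp_rev]
    simp only [tgt_rev, hω.1]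
  have h2 : ∑ d with G.src d = v, (max (ω d) 0 - max (-ω d) 0) = 0 := by
    refine Eq.trans (Finset.sum_congr rfl fun d _ => ?_) (hω.2 v)
    rcases le_total (ω d) 0 with h | h
    · rw [max_eq_right h, max_eq_left (by linarith)]; ring
    · rw [max_eq_left h, max_eq_right (by linarith)]; ring
  rw [Finset.sum_sub_distrib] at h2
  linarith

/-- The factor 2 cancels the one half in `RangeBound`, so that capacity 1 becomes height variation
1. -/
lemma IsFlow.sum_abs [Fintype D] [DecidableEq V] {G : TorusGraph V D} {ω : D → ℝ}
    (hω : G.IsFlow ω) (v : V) : ∑ d with G.src d = v, |ω d| = 2 * G.inflow ω v := by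
  have h : ∑ d with G.src d = v, (|ω d| + ω d) = ∑ d with G.src d = v, 2 * max (ω d) 0 := by
    refine Finset.sum_congr rfl fun d _ => ?_
    rcases le_total (ω d) 0 with h | h
    · rw [max_eq_right h, abs_of_nonpos h]; ring
    · rw [max_eq_left h, abs_of_nonneg h]; ring
  rw [Finset.sum_add_distrib, hω.2 v, add_zero, ← Finset.mul_sum, ← hω.inflow_eq] at h
  exact h

/-! ### Grid models -/

/-- A realization of a torus graph, up to its contractible loops, as a minor of the square grid
with period `N`: the vertices become disjoint connected sets of grid points, and the edges become
grid edges between these sets. -/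
structure GridModel (G : TorusGraph V D) where
  N : ℕ
  N_pos : 0 < N
  /-- the translation class of the end of an edge, relative to its start -/
  shift : D → ℤ × ℤ
  displacement_eq : ∀ d,
    G.displacement d = G.pos (G.tgt d) - G.pos (G.src d) + latticeVec (shift d)
  shift_rev : ∀ d, shift (G.rev d) = -shift d
  /-- the grid points contracted to a vertex -/
  blob : V → Finset (ℤ × ℤ)
  tree : ∀ v, GridTree (blob v)
  disjoint : ∀ v w x a, x ∈ blob v → x + (N : ℤ) • a ∈ blob w → v = w ∧ a = 0
  /-- the start of the grid edge of `d` -/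
  base : D → ℤ × ℤ
  /-- the direction of the grid edge of `d` -/
  dir : D → Fin 4
  base_mem : ∀ d, G.src d ≠ G.tgt d ∨ shift d ≠ 0 → base d ∈ blob (G.src d)
  base_rev : ∀ d, G.src d ≠ G.tgt d ∨ shift d ≠ 0 →
    base (G.rev d) = base d + step (dir d) - (N : ℤ) • shift d
  dir_rev : ∀ d, G.src d ≠ G.tgt d ∨ shift d ≠ 0 → dir (G.rev d) = dir d + 2
  edge_inj : ∀ d e, G.src d ≠ G.tgt d ∨ shift d ≠ 0 → G.src e ≠ G.tgt e ∨ shift e ≠ 0 →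
    base d = base e → dir d = dir e → d = e

namespace GridModel

variable {G : TorusGraph V D} (M : GridModel G)

/-- The edges that are not contractible loops. -/
def Ess (d : D) : Prop := G.src d ≠ G.tgt d ∨ M.shift d ≠ 0

lemma ess_rev {d : D} : M.Ess (G.rev d) ↔ M.Ess d := by
  rw [Ess, Ess, tgt_rev, M.shift_rev, neg_ne_zero, ne_comm]; rfl

lemma head_mem {d : D} (hd : M.Ess d) :
    M.base d + step (M.dir d) - (M.N : ℤ) • M.shift d ∈ M.blob (G.tgt d) := by
  rw [← M.base_rev d hd]
  exact M.base_mem _ (M.ess_rev.2 hd)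

/-- If both ends lay in the same lift of one blob, `d` would be a loop with zero shift, which `Ess`
excludes. -/
lemma head_notMem {d : D} (hd : M.Ess d) : M.base d + step (M.dir d) ∉ M.blob (G.src d) := by
  intro h
  have := M.disjoint _ _ _ (M.shift d) (M.head_mem hd) (by rwa [sub_add_cancel])
  rcases hd with hd | hd
  · exact hd this.1.symm
  · exact hd this.2

/-- The torus grid point below a grid point. -/
def proj (x : ℤ × ℤ) : ZMod M.N × ZMod M.N := (x.1, x.2)

lemma proj_add (x y : ℤ × ℤ) : M.proj (x + y) = M.proj x + M.proj y := by
  simp [proj]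

lemma proj_period (x a : ℤ × ℤ) : M.proj (x + (M.N : ℤ) • a) = M.proj x := by
  simp [proj]

lemma exists_of_proj_eq {x y : ℤ × ℤ} (h : M.proj x = M.proj y) :
    ∃ a : ℤ × ℤ, y = x + (M.N : ℤ) • a := by
  simp only [proj, Prod.mk.injEq, ZMod.intCast_eq_intCast_iff_dvd_sub] at h
  obtain ⟨⟨a, ha⟩, b, hb⟩ := h
  refine ⟨(a, b), Prod.ext ?_ ?_⟩
  · simp only [Prod.fst_add, Prod.smul_fst, smul_eq_mul]; linarith
  · simp only [Prod.snd_add, Prod.smul_snd, smul_eq_mul]; linarith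

lemma proj_surjective : Function.Surjective M.proj := by
  rintro ⟨a, b⟩
  obtain ⟨a, rfl⟩ := ZMod.intCast_surjective a
  obtain ⟨b, rfl⟩ := ZMod.intCast_surjective b
  exact ⟨(a, b), rfl⟩

/-- A function of grid points as a function of torus grid points. -/
noncomputable def descend {R : Type*} (g : ℤ × ℤ → R) (x : ZMod M.N × ZMod M.N) : R :=
  g (Function.surjInv M.proj_surjective x)

lemma descend_proj {R : Type*} {g : ℤ × ℤ → R} (hg : ∀ x a, g (x + (M.N : ℤ) • a) = g x)
    (x : ℤ × ℤ) : M.descend g (M.proj x) = g x := by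
  obtain ⟨a, ha⟩ := M.exists_of_proj_eq (Function.surjInv_eq M.proj_surjective (M.proj x)).symm
  rw [descend, ha, hg]

instance : NeZero M.N := ⟨M.N_pos.ne'⟩

lemma blob_unique {v w : V} {x a b : ℤ × ℤ} (h1 : x - (M.N : ℤ) • a ∈ M.blob v)
    (h2 : x - (M.N : ℤ) • b ∈ M.blob w) : v = w ∧ a = b := by
  have := M.disjoint v w _ (a - b) h1 (by
    rwa [smul_sub, show x - (M.N : ℤ) • a + ((M.N : ℤ) • a - (M.N : ℤ) • b)
      = x - (M.N : ℤ) • b by abel])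
  exact ⟨this.1, sub_eq_zero.1 this.2⟩

lemma blob_unique' {v w : V} {x b : ℤ × ℤ} (h1 : x ∈ M.blob v)
    (h2 : x - (M.N : ℤ) • b ∈ M.blob w) : v = w ∧ b = 0 := by
  have := M.blob_unique (a := 0) (by simpa using h1) h2
  exact ⟨this.1, this.2.symm⟩

/-! ### From heights to flows, and the homology class as periods -/

/-- The flow of the height function `h` runs only inside the blobs and along the model edges. -/
def Carries (h : ℤ × ℤ → ℝ) : Prop :=
  ∀ x q, jump h x q ≠ 0 →
    (∃ v a, x - (M.N : ℤ) • a ∈ M.blob v ∧ x + step q - (M.N : ℤ) • a ∈ M.blob v) ∨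
      ∃ d a, M.Ess d ∧ x - (M.N : ℤ) • a = M.base d ∧ q = M.dir d

open Classical in
/-- The flow on the torus graph of a height function on grid squares. -/
noncomputable def flowOf (h : ℤ × ℤ → ℝ) (d : D) : ℝ :=
  if M.Ess d then jump h (M.base d) (M.dir d) else 0

/-- `h` changes by `α` and `β` along the two periods. -/
def QuasiPeriodic (h : ℤ × ℤ → ℝ) (α β : ℝ) : Prop :=
  ∀ s a, h (s + (M.N : ℤ) • a) = h s + (a.1 * α + a.2 * β)

variable {M}

lemma QuasiPeriodic.jump_period {h : ℤ × ℤ → ℝ} {α β : ℝ} (hh : M.QuasiPeriodic h α β)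
    (x a : ℤ × ℤ) (q : Fin 4) : jump h (x + (M.N : ℤ) • a) q = jump h x q := by
  rw [jump, jump, add_right_comm x _ (corner q), add_right_comm x _ (corner (q + 3)), hh _ a,
    hh _ a]
  ring

lemma QuasiPeriodic.jump_period_sub {h : ℤ × ℤ → ℝ} {α β : ℝ} (hh : M.QuasiPeriodic h α β)
    (x a : ℤ × ℤ) (q : Fin 4) : jump h (x - (M.N : ℤ) • a) q = jump h x q := by
  rw [← hh.jump_period _ a, sub_add_cancel]

lemma flowOf_rev {h : ℤ × ℤ → ℝ} {α β : ℝ} (hh : M.QuasiPeriodic h α β) (d : D) :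
    M.flowOf h (G.rev d) = -M.flowOf h d := by
  by_cases hd : M.Ess d
  · rw [flowOf, flowOf, if_pos hd, if_pos (M.ess_rev.2 hd), M.base_rev d hd, M.dir_rev d hd,
      hh.jump_period_sub, jump_rev]
  · rw [flowOf, flowOf, if_neg hd, if_neg (fun h => hd (M.ess_rev.1 h)), neg_zero]

/-- Jumps sum to zero around every grid point of the blob. Edges inside the blob cancel with their
reverses, and among those leaving it only model edges carry flow. -/
lemma flowOf_isFlow [Fintype D] [DecidableEq V] {h : ℤ × ℤ → ℝ} {α β : ℝ}
    (hh : M.QuasiPeriodic h α β) (hc : M.Carries h) : G.IsFlow (M.flowOf h) := by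
  classical
  refine ⟨flowOf_rev hh, fun v => ?_⟩
  have h0 : ∑ p ∈ M.blob v ×ˢ (Finset.univ : Finset (Fin 4)), jump h p.1 p.2 = 0 := by
    rw [Finset.sum_product]
    exact Finset.sum_eq_zero fun x _ => sum_jump h x
  rw [← Finset.sum_filter_add_sum_filter_not _ (fun p => p.1 + step p.2 ∈ M.blob v)] at h0
  have h1 : ∑ p ∈ (M.blob v ×ˢ (Finset.univ : Finset (Fin 4))).filter
      (fun p => p.1 + step p.2 ∈ M.blob v), jump h p.1 p.2 = 0 := by
    refine Finset.sum_involution (fun p _ => (p.1 + step p.2, p.2 + 2)) ?_ ?_ ?_ ?_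
    · rintro ⟨x, q⟩ _
      rw [jump_rev, add_neg_cancel]
    · rintro ⟨x, q⟩ _ _ he
      simp only [Prod.mk.injEq] at he
      exact step_ne_zero q (left_eq_add.1 he.1.symm)
    · rintro ⟨x, q⟩ hx
      simp only [Finset.mem_filter, Finset.mem_product, Finset.mem_univ, and_true] at hx ⊢
      exact ⟨hx.2, by rw [add_step_rev]; exact hx.1⟩
    · rintro ⟨x, q⟩ _
      simp only [add_step_rev, dir_rev_rev]
  rw [h1, zero_add] at h0
  rw [← h0]
  have e1 : ∑ d with G.src d = v, M.flowOf h d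
      = ∑ d with (G.src d = v ∧ M.Ess d), M.flowOf h d := by
    rw [← Finset.filter_filter]
    refine (Finset.sum_filter_of_ne fun d _ hd => ?_).symm
    by_contra hne
    exact hd (if_neg hne)
  rw [e1]
  refine Finset.sum_of_injOn (fun d => (M.base d, M.dir d)) ?_ ?_ ?_ ?_
  · intro d hd e he hde
    simp only [Finset.coe_filter, Finset.mem_univ, true_and, Set.mem_ofPred_eq] at hd he
    simp only [Prod.mk.injEq] at hde
    exact M.edge_inj d e hd.2 he.2 hde.1 hde.2
  · intro d hd
    simp only [Finset.coe_filter, Finset.mem_univ, true_and, Set.mem_ofPred_eq,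
      Finset.mem_product, and_true] at hd ⊢
    rw [← hd.1]
    exact ⟨M.base_mem d hd.2, M.head_notMem hd.2⟩
  · rintro ⟨x, q⟩ hx hxe
    simp only [Finset.mem_filter, Finset.mem_product, Finset.mem_univ, and_true] at hx
    by_contra hne
    rcases hc x q hne with ⟨w, a, ha1, ha2⟩ | ⟨d, a, hd, ha1, ha2⟩
    · obtain ⟨rfl, rfl⟩ := M.blob_unique' hx.1 ha1
      exact hx.2 (by simpa using ha2)
    · have hb := M.base_mem d hd
      rw [← ha1] at hb
      obtain ⟨h3, rfl⟩ := M.blob_unique' hx.1 hb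
      apply hxe
      refine ⟨d, by simp [hd, h3], ?_⟩
      simp [← ha1, ← ha2]
  · intro d hd
    simp only [Finset.mem_filter] at hd
    rw [flowOf, if_pos hd.2.2]

/-- Displacements differ from the lattice shifts by the gradient of `G.pos`, against which a flow
pairs to zero. -/
lemma homologyClass_eq [Fintype V] [Fintype D] [DecidableEq V] (M : GridModel G) {ω : D → ℝ}
    (hω : G.IsFlow ω) :
    G.homologyClass ω = ((∑ d, ω d * (M.shift d).1) / 2, (∑ d, ω d * (M.shift d).2) / 2) := by
  have h := hω.sum_smul_sub G.pos
  have : ∑ d, ω d • G.displacement d = ∑ d, ω d • latticeVec (M.shift d) := by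
    simp only [M.displacement_eq, smul_add, Finset.sum_add_distrib, h, zero_add]
  rw [homologyClass, this]
  ext
  · simp [latticeVec, Prod.fst_sum]; ring
  · simp [latticeVec, Prod.snd_sum]; ring

open Classical in
/-- Measured by an additive function `c`, the difference between the translation class of the blob
of a grid point and the rescaled point itself. -/
noncomputable def deviation (M : GridModel G) (c : ℤ × ℤ →+ ℤ) (x : ℤ × ℤ) : ℝ :=
  if hx : ∃ p : V × (ℤ × ℤ), x - (M.N : ℤ) • p.2 ∈ M.blob p.1 then
    c hx.choose.2 - c x / M.N else 0

lemma deviation_eq (c : ℤ × ℤ →+ ℤ) {x a : ℤ × ℤ} {v : V}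
    (h : x - (M.N : ℤ) • a ∈ M.blob v) : M.deviation c x = c a - c x / M.N := by
  have hx : ∃ p : V × (ℤ × ℤ), x - (M.N : ℤ) • p.2 ∈ M.blob p.1 := ⟨(v, a), h⟩
  rw [deviation, dif_pos hx, (M.blob_unique hx.choose_spec h).2]

lemma deviation_period (c : ℤ × ℤ →+ ℤ) (x b : ℤ × ℤ) :
    M.deviation c (x + (M.N : ℤ) • b) = M.deviation c x := by
  have hN : (M.N : ℝ) ≠ 0 := Nat.cast_ne_zero.2 M.N_pos.ne'
  by_cases hx : ∃ p : V × (ℤ × ℤ), x - (M.N : ℤ) • p.2 ∈ M.blob p.1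
  · obtain ⟨⟨v, a⟩, ha⟩ := hx
    rw [deviation_eq c ha, deviation_eq c (a := a + b) (v := v)]
    · rw [map_add, map_add, map_zsmul]
      push_cast
      field_simp
      simp only [smul_eq_mul]
      push_cast
      ring
    · rwa [smul_add, show x + (M.N : ℤ) • b - ((M.N : ℤ) • a + (M.N : ℤ) • b)
        = x - (M.N : ℤ) • a by abel]
  · rw [deviation, deviation, dif_neg hx, dif_neg]
    rintro ⟨⟨v, a⟩, ha⟩
    apply hx
    refine ⟨(v, a - b), ?_⟩
    rwa [smul_sub, show x - ((M.N : ℤ) • a - (M.N : ℤ) • b)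
      = x + (M.N : ℤ) • b - (M.N : ℤ) • a by abel]

/-- The flow of `h` on the torus grid pairs to zero with the gradient of `deviation`. That gradient
is `-c (step q) / N` on an edge inside a blob and `c (shift d) - c (step q) / N` on a model edge;
all other edges carry no flow. -/
lemma sum_flowOf_shift [Fintype D] {h : ℤ × ℤ → ℝ} {α β : ℝ}
    (hh : M.QuasiPeriodic h α β) (hc : M.Carries h) (c : ℤ × ℤ →+ ℤ) :
    ∑ d, M.flowOf h d * c (M.shift d)
      = (∑ p : (ZMod M.N × ZMod M.N) × Fin 4,
          M.descend (fun x => jump h x p.2) p.1 * c (step p.2)) / M.N := by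
  classical
  have hN : (M.N : ℝ) ≠ 0 := Nat.cast_ne_zero.2 M.N_pos.ne'
  set f : (ZMod M.N × ZMod M.N) × Fin 4 → ℝ :=
    fun p => M.descend (fun x => jump h x p.2) p.1 with hf
  have hfp : ∀ x q, f (M.proj x, q) = jump h x q := fun x q =>
    M.descend_proj (fun x a => hh.jump_period x a q) x
  set ψ := M.descend (M.deviation c) with hψ
  have hψp : ∀ x, ψ (M.proj x) = M.deviation c x := M.descend_proj (deviation_period c)
  have z1 : ∑ p : (ZMod M.N × ZMod M.N) × Fin 4, f p * ψ p.1 = 0 := by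
    rw [Fintype.sum_prod_type]
    refine Finset.sum_eq_zero fun x _ => ?_
    obtain ⟨x, rfl⟩ := M.proj_surjective x
    simp only [hfp, ← Finset.sum_mul, sum_jump, zero_mul]
  have z2 : ∑ p : (ZMod M.N × ZMod M.N) × Fin 4, f p * ψ (p.1 + M.proj (step p.2)) = 0 := by
    rw [← neg_eq_zero, ← z1, ← Finset.sum_neg_distrib]
    refine Fintype.sum_bijective (fun p => (p.1 + M.proj (step p.2), p.2 + 2))
      (Function.Involutive.bijective ?_) _ _ ?_
    · rintro ⟨x, q⟩
      obtain ⟨x, rfl⟩ := M.proj_surjective x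
      simp only [← proj_add, add_step_rev, dir_rev_rev]
    · rintro ⟨x, q⟩
      obtain ⟨x, rfl⟩ := M.proj_surjective x
      simp only [← proj_add, hfp, jump_rev]
      ring
  have z3 : ∑ p : (ZMod M.N × ZMod M.N) × Fin 4,
      (f p * (ψ (p.1 + M.proj (step p.2)) - ψ p.1) + f p * c (step p.2) / M.N)
      = (∑ p : (ZMod M.N × ZMod M.N) × Fin 4, f p * c (step p.2)) / M.N := by
    rw [Finset.sum_add_distrib]
    simp only [mul_sub, Finset.sum_sub_distrib]
    rw [z1, z2, Finset.sum_div]; ring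
  rw [← z3]
  have e1 : ∑ d, M.flowOf h d * c (M.shift d)
      = ∑ d with M.Ess d, M.flowOf h d * c (M.shift d) := by
    refine (Finset.sum_filter_of_ne fun d _ hd => ?_).symm
    by_contra hne
    exact hd (by rw [flowOf, if_neg hne, zero_mul])
  rw [e1]
  refine Finset.sum_of_injOn (fun d => (M.proj (M.base d), M.dir d)) ?_ ?_ ?_ ?_
  · intro d hd e he hde
    simp only [Finset.coe_filter, Finset.mem_univ, true_and, Set.mem_ofPred_eq] at hd he
    simp only [Prod.mk.injEq] at hde
    obtain ⟨a, ha⟩ := M.exists_of_proj_eq hde.1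
    have := M.disjoint _ _ _ a (M.base_mem d hd) (ha ▸ M.base_mem e he)
    rw [this.2, smul_zero, add_zero] at ha
    exact M.edge_inj d e hd he ha.symm hde.2
  · intro d _
    simp
  · rintro ⟨x, q⟩ - hxe
    obtain ⟨x, rfl⟩ := M.proj_surjective x
    simp only [hfp, ← proj_add, hψp]
    by_cases hne : jump h x q = 0
    · simp [hne]
    rcases hc x q hne with ⟨w, a, ha1, ha2⟩ | ⟨d, a, hd, ha1, ha2⟩
    · rw [deviation_eq c ha1, deviation_eq c ha2, map_add]
      push_cast
      ring
    · exfalso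
      apply hxe
      refine ⟨d, by simpa using hd, ?_⟩
      simp only [Prod.mk.injEq]
      refine ⟨?_, ha2.symm⟩
      rw [← ha1, ← M.proj_period _ a, sub_add_cancel]
  · intro d hd
    have hd : M.Ess d := (Finset.mem_filter.1 hd).2
    simp only [hfp, ← proj_add, hψp]
    rw [deviation_eq c (M.head_mem hd), deviation_eq c (x := M.base d) (a := 0) (v := G.src d)
      (by simpa using M.base_mem d hd), flowOf, if_pos hd, map_add, map_zero]
    push_cast
    ring

/-- Subtracting its linear part from `h` leaves a periodic function `K`, whose jumps sum to zero
over the torus. Only the constant jump of the linear part remains, at each of the `N ^ 2` points. -/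
lemma sum_descend_jump {h : ℤ × ℤ → ℝ} {α β : ℝ} (hh : M.QuasiPeriodic h α β) (q : Fin 4) :
    ∑ x, M.descend (fun x => jump h x q) x
      = M.N * (((corner q).1 - (corner (q + 3)).1) * α
        + ((corner q).2 - (corner (q + 3)).2) * β) := by
  have hN : (M.N : ℝ) ≠ 0 := Nat.cast_ne_zero.2 M.N_pos.ne'
  let K : ℤ × ℤ → ℝ := fun s => h s - (s.1 * α + s.2 * β) / M.N
  have hK : ∀ x a, K (x + (M.N : ℤ) • a) = K x := by
    intro x a
    simp only [K, hh x a, Prod.fst_add, Prod.snd_add, Prod.smul_fst, Prod.smul_snd, smul_eq_mul]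
    push_cast
    field_simp
    ring
  have hs : ∀ r, ∑ x, M.descend K (x + M.proj (corner r)) = ∑ x, M.descend K x := fun r =>
    Equiv.sum_comp (Equiv.addRight (M.proj (corner r))) (M.descend K)
  have : ∀ x, M.descend (fun x => jump h x q) x = M.descend K (x + M.proj (corner q))
      - M.descend K (x + M.proj (corner (q + 3)))
      + (((corner q).1 - (corner (q + 3)).1) * α
        + ((corner q).2 - (corner (q + 3)).2) * β) / M.N := by
    intro x
    obtain ⟨x, rfl⟩ := M.proj_surjective x
    rw [M.descend_proj (fun x a => hh.jump_period x a q), ← proj_add, ← proj_add,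
      M.descend_proj hK, M.descend_proj hK]
    simp only [K, jump, Prod.fst_add, Prod.snd_add]
    push_cast
    field_simp
    ring
  simp only [this, Finset.sum_add_distrib, Finset.sum_sub_distrib, hs, sub_self, zero_add,
    Finset.sum_const, Finset.card_univ, Fintype.card_prod, ZMod.card, nsmul_eq_mul]
  push_cast
  field_simp

/-- The homology class of the flow of a height function is given by its periods. -/
lemma homologyClass_flowOf [Fintype V] [Fintype D] [DecidableEq V] {h : ℤ × ℤ → ℝ} {α β : ℝ}
    (hh : M.QuasiPeriodic h α β) (hc : M.Carries h) :
    G.homologyClass (M.flowOf h) = (β, -α) := by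
  have hN : (M.N : ℝ) ≠ 0 := Nat.cast_ne_zero.2 M.N_pos.ne'
  rw [M.homologyClass_eq (flowOf_isFlow hh hc)]
  have e1 : (1 : Fin 4) + 3 = 0 := by decide
  have e2 : (2 : Fin 4) + 3 = 1 := by decide
  have e3 : (3 : Fin 4) + 3 = 2 := by decide
  have key := fun c => sum_flowOf_shift hh hc c
  simp only [Fintype.sum_prod_type_right, ← Finset.sum_mul, sum_descend_jump hh,
    Fin.sum_univ_four, e1, e2, e3, zero_add] at key
  have k1 := key (AddMonoidHom.fst ℤ ℤ)
  have k2 := key (AddMonoidHom.snd ℤ ℤ)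
  simp [corner, step] at k1 k2
  rw [k1, k2]
  ext <;> simp <;> field_simp <;> ring

end GridModel

end TorusGraph

/-! ### From flows to heights -/

namespace TorusGraph

open SquareGrid

variable {V D : Type*} {G : TorusGraph V D}

namespace GridModel

open Classical in
/-- The periodic flow on the grid composed of a flow `ω` on the model edges and of the flows `F v`
inside the blobs. -/
noncomputable def gridFlow [Fintype V] [Fintype D] (M : GridModel G) (ω : D → ℝ)
    (F : V → ℤ × ℤ → Fin 4 → ℝ) (y : ℤ × ℤ) (q : Fin 4) : ℝ :=
  (∑ v, ∑ x ∈ M.blob v, if M.proj x = M.proj y then F v x q else 0) +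
    ∑ d, if M.Ess d ∧ M.proj (M.base d) = M.proj y ∧ M.dir d = q then ω d else 0

open Classical in
/-- The inflow at a grid point of the blob of `v` through model edges. -/
noncomputable def demand [Fintype D] (M : GridModel G) (ω : D → ℝ) (v : V) (x : ℤ × ℤ) : ℝ :=
  -∑ d, if M.Ess d ∧ G.src d = v ∧ M.base d = x then ω d else 0

lemma sum_demand [Fintype D] [DecidableEq V] {M : GridModel G} {ω : D → ℝ}
    (hω : G.IsFlow ω) (h0 : ∀ d, ω d ≠ 0 → M.Ess d) (v : V) :
    ∑ x ∈ M.blob v, M.demand ω v x = 0 := by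
  classical
  simp only [demand, Finset.sum_neg_distrib]
  rw [Finset.sum_comm, neg_eq_zero]
  refine Eq.trans (Finset.sum_congr rfl fun d _ => ?_)
    ((Finset.sum_filter (fun d => G.src d = v) ω).symm.trans (hω.2 v))
  by_cases hd : M.Ess d
  · by_cases hv : G.src d = v
    · subst hv
      simp [hd, M.base_mem d hd]
    · simp [hv]
  · have : ω d = 0 := by
      by_contra hne
      exact hd (h0 d hne)
    simp [this]

variable [Fintype V] [Fintype D] {M : GridModel G} {ω : D → ℝ} {F : V → ℤ × ℤ → Fin 4 → ℝ}

lemma gridFlow_rev (hω : ∀ d, ω (G.rev d) = -ω d)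
    (hF : ∀ v x q, F v (x + step q) (q + 2) = -F v x q)
    (hFs : ∀ v x q, F v x q ≠ 0 → x ∈ M.blob v ∧ x + step q ∈ M.blob v) (y : ℤ × ℤ) (q : Fin 4) :
    M.gridFlow ω F (y + step q) (q + 2) = -M.gridFlow ω F y q := by
  classical
  rw [gridFlow, gridFlow, neg_add]
  congr 1
  · rw [← Finset.sum_neg_distrib]
    refine Finset.sum_congr rfl fun v _ => ?_
    rw [← Finset.sum_neg_distrib]
    symm
    refine Finset.sum_bij_ne_zero (fun x _ _ => x + step q) ?_ ?_ ?_ ?_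
    · intro x _ hne
      refine (hFs v x q fun h0 => hne ?_).2
      simp [h0]
    · intro x _ _ z _ _ h
      exact add_right_cancel h
    · intro x _ hne
      have e : x + step (q + 2) + step q = x := by
        have := add_step_rev x (q + 2)
        rwa [dir_rev_rev] at this
      have h1 : M.proj x = M.proj (y + step q) ∧ F v x (q + 2) ≠ 0 := by
        by_contra hc
        apply hne
        split_ifs with h
        · by_contra h3
          exact hc ⟨h, h3⟩
        · rfl
      have h2 := hF v (x + step (q + 2)) q
      rw [e] at h2
      refine ⟨x + step (q + 2), (hFs v x (q + 2) h1.2).2, ?_, e⟩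
      rw [if_pos, ← h2]
      · exact h1.2
      · have := congrArg (· + M.proj (step (q + 2))) h1.1
        simpa only [← proj_add, add_step_rev] using this
    · intro x _ _
      simp only [proj_add, add_left_inj, hF]
      split_ifs <;> simp
  · rw [← G.sum_comp_rev, ← Finset.sum_neg_distrib]
    refine Finset.sum_congr rfl fun d _ => ?_
    have : (M.Ess (G.rev d) ∧ M.proj (M.base (G.rev d)) = M.proj (y + step q)
        ∧ M.dir (G.rev d) = q + 2) ↔
        (M.Ess d ∧ M.proj (M.base d) = M.proj y ∧ M.dir d = q) := by
      rw [M.ess_rev]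
      refine and_congr_right fun hd => ?_
      rw [M.base_rev d hd, M.dir_rev d hd, add_left_inj,
        ← M.proj_period _ (M.shift d), sub_add_cancel]
      constructor
      · rintro ⟨h1, rfl⟩
        rw [proj_add, proj_add, add_left_inj] at h1
        exact ⟨h1, rfl⟩
      · rintro ⟨h1, rfl⟩
        rw [proj_add, proj_add, h1]
        exact ⟨rfl, rfl⟩
    simp only [this, hω]
    split_ifs <;> simp

/-- The outflow of `F v` at a point of a blob is `demand`, the negative of the outflow along model
edges; off the blobs and their translates both parts vanish. -/
lemma sum_gridFlow (hFd : ∀ v, ∀ x ∈ M.blob v, ∑ q, F v x q = M.demand ω v x) (y : ℤ × ℤ) :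
    ∑ q, M.gridFlow ω F y q = 0 := by
  classical
  simp only [gridFlow]
  rw [Finset.sum_add_distrib, Finset.sum_comm]
  have e1 : ∑ v, ∑ q, ∑ x ∈ M.blob v, (if M.proj x = M.proj y then F v x q else 0)
      = -∑ d, if M.Ess d ∧ M.proj (M.base d) = M.proj y then ω d else 0 := by
    have : ∀ v, ∑ q, ∑ x ∈ M.blob v, (if M.proj x = M.proj y then F v x q else 0)
        = -∑ d, if (M.Ess d ∧ M.proj (M.base d) = M.proj y) ∧ G.src d = v then ω d else 0 := by
      intro v
      rw [Finset.sum_comm]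
      have : ∀ x ∈ M.blob v, ∑ q, (if M.proj x = M.proj y then F v x q else 0)
          = -∑ d, if M.Ess d ∧ M.proj (M.base d) = M.proj y ∧ G.src d = v ∧ M.base d = x
            then ω d else 0 := by
        intro x hx
        split_ifs with h
        · rw [hFd v x hx, demand]
          congr 1
          refine Finset.sum_congr rfl fun d _ => ?_
          congr 1
          apply propext
          constructor
          · rintro ⟨h1, h2, h3⟩
            exact ⟨h1, by rw [h3, h], h2, h3⟩
          · rintro ⟨h1, -, h2, h3⟩
            exact ⟨h1, h2, h3⟩
        · rw [Finset.sum_const_zero, eq_comm, neg_eq_zero]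
          refine Finset.sum_eq_zero fun d _ => if_neg ?_
          rintro ⟨-, h2, -, rfl⟩
          exact h h2
      rw [Finset.sum_congr rfl this, Finset.sum_neg_distrib, Finset.sum_comm]
      congr 1
      refine Finset.sum_congr rfl fun d _ => ?_
      by_cases hd : M.Ess d ∧ M.proj (M.base d) = M.proj y
      · by_cases hv : G.src d = v
        · subst hv
          simp [hd.1, hd.2, M.base_mem d hd.1]
        · simp [hv]
      · rw [if_neg (fun h => hd h.1)]
        refine Finset.sum_eq_zero fun x _ => if_neg ?_
        rintro ⟨h1, h2, -⟩
        exact hd ⟨h1, h2⟩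
    rw [Finset.sum_congr rfl fun v _ => this v, Finset.sum_neg_distrib, Finset.sum_comm]
    congr 1
    refine Finset.sum_congr rfl fun d _ => ?_
    by_cases hd : M.Ess d ∧ M.proj (M.base d) = M.proj y <;> simp [hd]
  have e2 : ∑ q, ∑ d, (if M.Ess d ∧ M.proj (M.base d) = M.proj y ∧ M.dir d = q then ω d else 0)
      = ∑ d, if M.Ess d ∧ M.proj (M.base d) = M.proj y then ω d else 0 := by
    rw [Finset.sum_comm]
    refine Finset.sum_congr rfl fun d _ => ?_
    by_cases hd : M.Ess d ∧ M.proj (M.base d) = M.proj y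
    · simp [hd.1, hd.2]
    · rw [if_neg hd]
      refine Finset.sum_eq_zero fun q _ => if_neg ?_
      rintro ⟨h1, h2, -⟩
      exact hd ⟨h1, h2⟩
  rw [e1, e2, neg_add_cancel]

open Classical in
lemma gridFlow_of_mem {v : V} {x : ℤ × ℤ} (hx : x ∈ M.blob v) (q : Fin 4) :
    M.gridFlow ω F x q = F v x q
      + ∑ d, if M.Ess d ∧ G.src d = v ∧ M.base d = x ∧ M.dir d = q then ω d else 0 := by
  have hp : ∀ w, ∀ z ∈ M.blob w, M.proj z = M.proj x → w = v ∧ z = x := by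
    intro w z hz h
    obtain ⟨a, rfl⟩ := M.exists_of_proj_eq h
    obtain ⟨h1, rfl⟩ := M.disjoint _ _ _ _ hz hx
    exact ⟨h1, by simp⟩
  rw [gridFlow]
  congr 1
  · rw [Finset.sum_eq_single_of_mem v (Finset.mem_univ _), Finset.sum_eq_single_of_mem x hx,
      if_pos rfl]
    · intro z hz hne
      exact if_neg fun h => hne (hp v z hz h).2
    · intro w _ hne
      exact Finset.sum_eq_zero fun z hz => if_neg fun h => hne (hp w z hz h).1
  · refine Finset.sum_congr rfl fun d _ => ?_
    congr 1
    apply propext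
    refine and_congr_right fun hd => ?_
    rw [← and_assoc]
    refine and_congr_left fun _ => ⟨fun h => hp _ _ (M.base_mem d hd) h, fun h => by rw [h.2]⟩

/-- Every flow on the essential edges is the flow of a height function on the squares of the grid,
and around each blob the heights vary by at most the inflow at the vertex. -/
lemma exists_height [DecidableEq V] (M : GridModel G) (hω : G.IsFlow ω)
    (h0 : ∀ d, ω d ≠ 0 → M.Ess d) :
    ∃ h α β, M.QuasiPeriodic h α β ∧ M.Carries h ∧ M.flowOf h = ω ∧
      ∀ v, ∀ x ∈ M.blob v, ∀ q, ∀ y ∈ M.blob v, ∀ p,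
        |h (x + corner q) - h (y + corner p)| ≤ G.inflow ω v := by
  classical
  choose F F1 F2 F3 F4 using fun v =>
    (M.tree v).exists_routing (M.demand ω v) (sum_demand hω h0 v)
  obtain ⟨h, hh⟩ := SquareGrid.exists_height (M.gridFlow ω F) (gridFlow_rev hω.1 F1 F2)
    (sum_gridFlow F3)
  have hper : ∀ a x q, jump h (x + (M.N : ℤ) • a) q = jump h x q := by
    intro a x q
    rw [hh, hh]
    simp only [gridFlow, proj_period]
  obtain ⟨α, hα⟩ := exists_period (hper (1, 0))
  obtain ⟨β, hβ⟩ := exists_period (hper (0, 1))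
  have hout : ∀ v, ∀ x ∈ M.blob v, ∀ q, x + step q ∉ M.blob v → jump h x q
      = ∑ d, if M.Ess d ∧ G.src d = v ∧ M.base d = x ∧ M.dir d = q then ω d else 0 := by
    intro v x hx q hq
    have : F v x q = 0 := by
      by_contra hne
      exact hq (F2 v x q hne).2
    rw [hh, gridFlow_of_mem hx, this, zero_add]
    congr!
  refine ⟨h, α, β, ?_, ?_, ?_, ?_⟩
  · intro s a
    have e : (M.N : ℤ) • a
        = a.1 • ((M.N : ℤ) • ((1, 0) : ℤ × ℤ)) + a.2 • ((M.N : ℤ) • ((0, 1) : ℤ × ℤ)) := by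
      ext <;> simp [mul_comm]
    rw [e, ← add_assoc, period_smul hβ, period_smul hα]
    ring
  · intro x q hne
    rw [hh, gridFlow] at hne
    by_cases h1 : ∑ v, ∑ z ∈ M.blob v, (if M.proj z = M.proj x then F v z q else 0) = 0
    · rw [h1, zero_add] at hne
      obtain ⟨d, -, hd⟩ := Finset.exists_ne_zero_of_sum_ne_zero hne
      have hd' := (ite_ne_right_iff.1 hd).1
      obtain ⟨a, ha⟩ := M.exists_of_proj_eq hd'.2.1
      exact Or.inr ⟨d, a, hd'.1, by rw [ha, add_sub_cancel_right], hd'.2.2.symm⟩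
    · obtain ⟨v, -, hv⟩ := Finset.exists_ne_zero_of_sum_ne_zero h1
      obtain ⟨z, hz, hv⟩ := Finset.exists_ne_zero_of_sum_ne_zero hv
      obtain ⟨h2, h3⟩ := ite_ne_right_iff.1 hv
      obtain ⟨a, ha⟩ := M.exists_of_proj_eq h2
      refine Or.inl ⟨v, a, ?_, ?_⟩
      · rwa [ha, add_sub_cancel_right]
      · rw [ha, add_right_comm, add_sub_cancel_right]
        exact (F2 v z q h3).2
  · funext d
    by_cases hd : M.Ess d
    · rw [flowOf, if_pos hd, hout _ _ (M.base_mem d hd) _ (M.head_notMem hd),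
        Finset.sum_eq_single_of_mem d (Finset.mem_univ _)]
      · simp [hd]
      · intro e _ hne
        refine if_neg ?_
        rintro ⟨h1, -, h2, h3⟩
        exact hne (M.edge_inj e d h1 hd h2 h3)
    · rw [flowOf, if_neg hd]
      by_contra hne
      exact hd (h0 d (Ne.symm hne))
  · intro v x hx q y hy p
    -- Model edges leave their blob, so inside it the jumps of `h` are those of the tree routing
    -- alone.
    have hR : RangeBound h (M.blob v) := by
      refine F4 v h fun z hz q hzq => ?_
      rw [hh, gridFlow_of_mem hz, add_eq_left]
      refine Finset.sum_eq_zero fun d _ => if_neg ?_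
      rintro ⟨h1, rfl, rfl, rfl⟩
      exact M.head_notMem h1 hzq
    refine (hR x hx q y hy p).trans ?_
    suffices hs : boundaryFlux (jump h) (M.blob v) ≤ ∑ d with G.src d = v, |ω d| by
      rw [hω.sum_abs] at hs
      linarith
    have b1 : boundaryFlux (jump h) (M.blob v) ≤ ∑ z ∈ M.blob v, ∑ q, ∑ d,
        if M.Ess d ∧ G.src d = v ∧ M.base d = z ∧ M.dir d = q then |ω d| else 0 := by
      refine Finset.sum_le_sum fun z hz => Finset.sum_le_sum fun q _ => ?_
      split_ifs with hq
      · exact Finset.sum_nonneg fun d _ => by split_ifs <;> simp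
      · rw [hout v z hz q hq]
        refine (Finset.abs_sum_le_sum_abs _ _).trans (Finset.sum_le_sum fun d _ => ?_)
        split_ifs <;> simp
    refine b1.trans ?_
    rw [Finset.sum_filter]
    simp only [Finset.sum_comm (s := (Finset.univ : Finset (Fin 4)))]
    rw [Finset.sum_comm]
    refine Finset.sum_le_sum fun d _ => ?_
    by_cases hd : M.Ess d ∧ G.src d = v
    · obtain ⟨hd, rfl⟩ := hd
      simp [hd, ite_and, M.base_mem d hd]
    · have : ∑ z ∈ M.blob v, ∑ q,
          (if M.Ess d ∧ G.src d = v ∧ M.base d = z ∧ M.dir d = q then |ω d| else 0) = 0 :=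
        Finset.sum_eq_zero fun z _ => Finset.sum_eq_zero fun q _ =>
          if_neg fun h => hd ⟨h.1, h.2.1⟩
      rw [this]
      split_ifs <;> simp

end GridModel

end TorusGraph

/-! ### Rounding the heights -/

namespace TorusGraph

open SquareGrid

/-- The thresholds `m + k n` are at least 1 apart, so a gap of length at most 1, closed at its upper
end only, contains at most one of them. -/
lemma floor_gap {a b m : ℝ} {k : ℕ} (hk : 0 < k) (hab : |a - b| ≤ 1)
    (hne : ⌊(a - m) / k⌋ ≠ ⌊(b - m) / k⌋) :
    ∃ n : ℤ, (b < m + k * n ∧ m + k * n ≤ a ∧ ⌊(a - m) / k⌋ = n ∧ ⌊(b - m) / k⌋ = n - 1) ∨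
      (a < m + k * n ∧ m + k * n ≤ b ∧ ⌊(b - m) / k⌋ = n ∧ ⌊(a - m) / k⌋ = n - 1) := by
  have key : ∀ a b : ℝ, a - b ≤ 1 → ⌊(b - m) / k⌋ < ⌊(a - m) / k⌋ →
      b < m + k * ⌊(a - m) / k⌋ ∧ m + k * ⌊(a - m) / k⌋ ≤ a ∧
        ⌊(b - m) / k⌋ = ⌊(a - m) / k⌋ - 1 := by
    intro a b hab hlt
    have hk0 : (0 : ℝ) < k := Nat.cast_pos.2 hk
    have hk1 : (1 : ℝ) ≤ k := Nat.one_le_cast.2 hk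
    have h1 := Int.floor_le ((a - m) / k)
    have h2 := Int.floor_lt.1 hlt
    rw [le_div_iff₀ hk0] at h1
    rw [div_lt_iff₀ hk0] at h2
    refine ⟨by linarith, by linarith, le_antisymm (by omega) ?_⟩
    rw [Int.le_floor, le_div_iff₀ hk0]
    push_cast
    linarith
  rw [abs_le] at hab
  rcases lt_or_gt_of_ne hne with h | h
  · obtain ⟨h1, h2, h3⟩ := key b a (by linarith) h
    exact ⟨_, Or.inr ⟨h1, h2, rfl, h3⟩⟩
  · obtain ⟨h1, h2, h3⟩ := key a b (by linarith) h
    exact ⟨_, Or.inl ⟨h1, h2, rfl, h3⟩⟩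

namespace GridModel

variable {V D : Type*} {G : TorusGraph V D} {M : GridModel G}

/-- The heights around the blob of `v` lie on both sides of the level `t`. -/
def Straddles (M : GridModel G) (h : ℤ × ℤ → ℝ) (v : V) (t : ℤ) : Prop :=
  ∃ x ∈ M.blob v, ∃ q, ∃ y ∈ M.blob v, ∃ p, h (x + corner q) < t ∧ t ≤ h (y + corner p)

/-- For levels `t < u` there would be one height below `t` and one at or above `u`, more than 1
apart. The strict inequality on one side of `Straddles` is what admits a variation of exactly 1. -/
lemma Straddles.unique {h : ℤ × ℤ → ℝ} {v : V} {t u : ℤ}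
    (hh : ∀ x ∈ M.blob v, ∀ q, ∀ y ∈ M.blob v, ∀ p, |h (x + corner q) - h (y + corner p)| ≤ 1)
    (ht : M.Straddles h v t) (hu : M.Straddles h v u) : t = u := by
  obtain ⟨x, hx, q, y, hy, p, h1, h2⟩ := ht
  obtain ⟨x', hx', q', y', hy', p', h3, h4⟩ := hu
  have b1 := abs_le.1 (hh y hy p x' hx' q')
  have b2 := abs_le.1 (hh y' hy' p' x hx q)
  by_contra hne
  rcases lt_or_gt_of_ne hne with hlt | hlt
  · have : (t : ℝ) + 1 ≤ u := by exact_mod_cast hlt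
    linarith
  · have : (u : ℝ) + 1 ≤ t := by exact_mod_cast hlt
    linarith

/-- Rounding: a flow of capacity `1` and of class `k • (p, q)` yields `k` flows of class `(p, q)`
with values in `{0, 1, -1}` and with vertex-disjoint supports. The potential `T` forces all cycles
in these supports to have a class parallel to `(p, q)`. -/
lemma exists_rounding [Fintype V] [Fintype D] [DecidableEq V] (M : GridModel G) {ω : D → ℝ}
    (hω : G.IsFlow ω) (h0 : ∀ d, ω d ≠ 0 → M.Ess d) (hcap : ∀ v, G.inflow ω v ≤ 1)
    {k : ℕ} (hk : 0 < k) (p q : ℤ) (hcl : G.homologyClass ω = ((k * p : ℝ), (k * q : ℝ))) :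
    ∃ (η : Fin k → D → ℝ) (T : V → ℤ),
      (∀ m, G.IsFlow (η m)) ∧
      (∀ m d, η m d = 0 ∨ η m d = 1 ∨ η m d = -1) ∧
      (∀ m d, η m d ≠ 0 → ω d ≠ 0) ∧
      (∀ m, G.homologyClass (η m) = ((p : ℝ), (q : ℝ))) ∧
      (∀ m m' d d', η m d ≠ 0 → η m' d' ≠ 0 → G.src d = G.src d' → m = m') ∧
      (∀ m d, η m d ≠ 0 →
        T (G.src d) - T (G.tgt d) = k * (p * (M.shift d).2 - q * (M.shift d).1)) := by
  classical
  obtain ⟨h, α, β, hper, hcar, hfl, hrange⟩ := M.exists_height hω h0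
  have hcl' := homologyClass_flowOf hper hcar
  rw [hfl, hcl, Prod.mk.injEq] at hcl'
  obtain ⟨hβ, hα⟩ := hcl'
  have hk0 : (k : ℝ) ≠ 0 := Nat.cast_ne_zero.2 hk.ne'
  have hr1 : ∀ v, ∀ x ∈ M.blob v, ∀ q, ∀ y ∈ M.blob v, ∀ p,
      |h (x + corner q) - h (y + corner p)| ≤ 1 :=
    fun v x hx q y hy p => (hrange v x hx q y hy p).trans (hcap v)
  -- `H m` jumps exactly where `h` crosses a level congruent to `m` mod `k`. The periods of `h` are
  -- multiples of `k`, so those of `H m` are integers.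
  let H : Fin k → ℤ × ℤ → ℝ := fun m s => ⌊(h s - (m : ℕ)) / k⌋
  have Hjump : ∀ m x q, jump (H m) x q ≠ 0 → jump h x q ≠ 0 := by
    intro m x q hne h0
    apply hne
    simp only [jump, H] at h0 ⊢
    rw [sub_eq_zero.1 h0, sub_self]
  have Hper : ∀ m, M.QuasiPeriodic (H m) (-q) p := by
    intro m s a
    simp only [H]
    rw [hper s a, show (h s + (a.1 * α + a.2 * β) - (m : ℕ)) / k
      = (h s - (m : ℕ)) / k + ((a.2 * p - a.1 * q : ℤ) : ℝ) by
        rw [← hβ, show α = -(k * q) by linarith]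
        push_cast
        field_simp
        ring, Int.floor_add_intCast]
    push_cast
    ring
  have Hcar : ∀ m, M.Carries (H m) := fun m x q hne => hcar x q (Hjump m x q hne)
  have Hess : ∀ m d, M.flowOf (H m) d ≠ 0 → M.Ess d := fun m d hne =>
    by_contra fun hd => hne (if_neg hd)
  have Hgap : ∀ m d, M.flowOf (H m) d ≠ 0 → ∃ n : ℤ,
      (M.flowOf (H m) d = 1 ∨ M.flowOf (H m) d = -1) ∧ M.Straddles h (G.src d) (m + k * n) ∧
        M.Straddles h (G.tgt d)
          (m + k * n - k * (p * (M.shift d).2 - q * (M.shift d).1)) := by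
    intro m d hne
    have hd := Hess m d hne
    have hb := M.base_mem d hd
    have hb' := M.base_mem _ (M.ess_rev.2 hd)
    -- The two squares beside the grid edge of `d` touch the blob of its source and a translate of
    -- the blob of its target. So both ends straddle the same level, up to the height period along
    -- `shift d`.
    have e1 : h (M.base (G.rev d) + corner (M.dir d + 2 + 3))
        = h (M.base d + corner (M.dir d))
          - (k * (p * (M.shift d).2 - q * (M.shift d).1) : ℤ) := by
      have := hper (M.base (G.rev d) + corner (M.dir d + 2 + 3)) (M.shift d)
      rw [M.base_rev d hd, add_right_comm, sub_add_cancel, add_assoc, step_add_corner', ← hβ,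
        show α = -(k * q) by linarith] at this
      rw [M.base_rev d hd, this]
      push_cast
      ring
    have e2 : h (M.base (G.rev d) + corner (M.dir d + 2))
        = h (M.base d + corner (M.dir d + 3))
          - (k * (p * (M.shift d).2 - q * (M.shift d).1) : ℤ) := by
      have := hper (M.base (G.rev d) + corner (M.dir d + 2)) (M.shift d)
      rw [M.base_rev d hd, add_right_comm, sub_add_cancel, add_assoc, step_add_corner, ← hβ,
        show α = -(k * q) by linarith] at this
      rw [M.base_rev d hd, this]
      push_cast
      ring
    rw [flowOf, if_pos hd] at hne ⊢
    simp only [jump, H] at hne ⊢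
    obtain ⟨n, hn⟩ := floor_gap (m := (m : ℕ)) hk
      (hr1 _ _ hb (M.dir d) _ hb (M.dir d + 3))
      (fun h' => hne (by rw [h', sub_self]))
    refine ⟨n, ?_⟩
    rcases hn with ⟨h1, h2, h3, h4⟩ | ⟨h1, h2, h3, h4⟩
    · refine ⟨Or.inl ?_, ⟨_, hb, M.dir d + 3, _, hb, M.dir d, ?_, ?_⟩,
        ⟨_, hb', M.dir d + 2, _, hb', M.dir d + 2 + 3, ?_, ?_⟩⟩
      · rw [h3, h4]; push_cast; ring
      · push_cast; exact h1
      · push_cast; exact h2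
      · rw [e2]; push_cast; linarith
      · rw [e1]; push_cast; linarith
    · refine ⟨Or.inr ?_, ⟨_, hb, M.dir d, _, hb, M.dir d + 3, ?_, ?_⟩,
        ⟨_, hb', M.dir d + 2 + 3, _, hb', M.dir d + 2, ?_, ?_⟩⟩
      · rw [h3, h4]; push_cast; ring
      · push_cast; exact h1
      · push_cast; exact h2
      · rw [e1]; push_cast; linarith
      · rw [e2]; push_cast; linarith
  -- The default value is harmless: both ends of every edge in the supports straddle some level.
  let T : V → ℤ := fun v => if hv : ∃ t, M.Straddles h v t then hv.choose else 0
  have hT : ∀ v t, M.Straddles h v t → T v = t := by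
    intro v t ht
    have hv : ∃ t, M.Straddles h v t := ⟨t, ht⟩
    simp only [T, dif_pos hv]
    exact hv.choose_spec.unique (hr1 v) ht
  refine ⟨fun m => M.flowOf (H m), T, fun m => flowOf_isFlow (Hper m) (Hcar m), ?_, ?_, ?_, ?_, ?_⟩
  · intro m d
    by_cases hne : M.flowOf (H m) d = 0
    · exact Or.inl hne
    · exact Or.inr (Hgap m d hne).choose_spec.1
  · intro m d hne
    have hd := Hess m d hne
    change M.flowOf (H m) d ≠ 0 at hne
    rw [← hfl]
    rw [flowOf, if_pos hd] at hne ⊢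
    exact Hjump m _ _ hne
  · intro m
    rw [homologyClass_flowOf (Hper m) (Hcar m), neg_neg]
  · intro m m' d d' hm hm' hs
    obtain ⟨n, -, h1, -⟩ := Hgap m d hm
    obtain ⟨n', -, h2, -⟩ := Hgap m' d' hm'
    rw [hs] at h1
    have e := h1.unique (hr1 _) h2
    -- The common level is `m + k n = m' + k n'` with `m, m' < k`, so its residue determines `m`.
    have e' := congrArg (· % (k : ℤ)) e
    simp only [Int.add_mul_emod_self_left] at e'
    rw [Int.emod_eq_of_lt (by positivity) (by exact_mod_cast m.2),
      Int.emod_eq_of_lt (by positivity) (by exact_mod_cast m'.2)] at e'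
    exact Fin.ext (by exact_mod_cast e')
  · intro m d hne
    obtain ⟨n, -, h1, h2⟩ := Hgap m d hne
    rw [hT _ _ h1, hT _ _ h2]
    ring

end GridModel

end TorusGraph

/-! ### Loops and their unit flows -/

namespace TorusGraph

variable {V D : Type*}

/-- A loop of a torus graph that does not traverse any edge in both directions, with the map that
sends an edge of the loop to the next one. -/
structure DirectedLoop (G : TorusGraph V D) where
  cycle : Cycle D
  isLoop : G.IsLoop cycle
  next : D → D
  start : D
  start_mem : start ∈ cycle
  next_mem : ∀ d ∈ cycle, next d ∈ cycle
  src_next : ∀ d ∈ cycle, G.src (next d) = G.tgt d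
  next_inj : ∀ d ∈ cycle, ∀ e ∈ cycle, next d = next e → d = e
  next_surj : ∀ e ∈ cycle, ∃ d ∈ cycle, next d = e
  reach : ∀ d ∈ cycle, ∃ n, next^[n] start = d
  src_inj : ∀ d ∈ cycle, ∀ e ∈ cycle, G.src d = G.src e → d = e
  rev_notMem : ∀ d ∈ cycle, G.rev d ∉ cycle

/-- In a finite graph a nonempty set of oriented edges, each of which ends where some edge of the
set starts, contains a loop. -/
lemma exists_directedLoop [Finite D] (G : TorusGraph V D) (P : Set D) (hne : P.Nonempty)
    (hrev : ∀ d ∈ P, G.rev d ∉ P) (hP : ∀ d ∈ P, ∃ e ∈ P, G.src e = G.tgt d) :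
    ∃ L : G.DirectedLoop, ∀ d ∈ L.cycle, d ∈ P := by
  classical
  obtain ⟨d₀, hd₀⟩ := hne
  -- The successor of an edge depends only on its end vertex, so a periodic orbit of `next` passes
  -- through each vertex at most once.
  let out : V → D := fun v => if hv : ∃ e ∈ P, G.src e = v then hv.choose else d₀
  have hout : ∀ v, (∃ e ∈ P, G.src e = v) → out v ∈ P ∧ G.src (out v) = v := by
    intro v hv
    simp only [out, dif_pos hv]
    exact hv.choose_spec
  let next : D → D := fun d => out (G.tgt d)
  have hnext : ∀ d ∈ P, next d ∈ P ∧ G.src (next d) = G.tgt d := fun d hd => hout _ (hP d hd)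
  have hit : ∀ n, ∀ d ∈ P, next^[n] d ∈ P := by
    intro n
    induction n with
    | zero => exact fun d hd => hd
    | succ n ih =>
      intro d hd
      rw [Function.iterate_succ_apply]
      exact ih _ (hnext d hd).1
  obtain ⟨m, n, hmn, he⟩ := Finite.exists_ne_map_eq_of_infinite fun n : ℕ => next^[n] d₀
  obtain ⟨d₁, hd₁, hper⟩ : ∃ d₁ ∈ P, d₁ ∈ Function.periodicPts next := by
    wlog hlt : m < n generalizing m n
    · exact this n m hmn.symm he.symm (by omega)
    refine ⟨next^[m] d₀, hit m d₀ hd₀, n - m, by omega, ?_⟩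
    rw [Function.IsPeriodicPt, Function.IsFixedPt, ← Function.iterate_add_apply,
      Nat.sub_add_cancel hlt.le]
    exact he.symm
  have hmem : ∀ d, d ∈ Function.periodicOrbit next d₁ ↔ ∃ n, next^[n] d₁ = d := fun d =>
    Function.mem_periodicOrbit_iff hper
  have hPmem : ∀ d ∈ Function.periodicOrbit next d₁, d ∈ P := by
    intro d hd
    obtain ⟨n, rfl⟩ := (hmem d).1 hd
    exact hit n _ hd₁
  have hnm : ∀ d ∈ Function.periodicOrbit next d₁, next d ∈ Function.periodicOrbit next d₁ := by
    intro d hd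
    obtain ⟨n, rfl⟩ := (hmem d).1 hd
    exact (hmem _).2 ⟨n + 1, Function.iterate_succ_apply' _ _ _⟩
  have hperiodic : ∀ d ∈ Function.periodicOrbit next d₁, d ∈ Function.periodicPts next := by
    intro d hd
    obtain ⟨n, rfl⟩ := (hmem d).1 hd
    obtain ⟨m, hm, hm'⟩ := hper
    exact ⟨m, hm, hm'.apply_iterate n⟩
  have hsurj : ∀ e ∈ Function.periodicOrbit next d₁,
      ∃ d ∈ Function.periodicOrbit next d₁, next d = e := by
    intro e he
    obtain ⟨n, rfl⟩ := (hmem e).1 he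
    obtain ⟨m, hm, hm'⟩ := hper
    refine ⟨next^[n + m - 1] d₁, (hmem _).2 ⟨_, rfl⟩, ?_⟩
    rw [← Function.iterate_succ_apply' next, show (n + m - 1).succ = n + m by omega,
      Function.iterate_add_apply, hm'.eq]
  have hsrc : ∀ e ∈ Function.periodicOrbit next d₁, out (G.src e) = e := by
    intro e he
    obtain ⟨d, hd, rfl⟩ := hsurj e he
    rw [(hnext d (hPmem d hd)).2]
  have hsinj : ∀ d ∈ Function.periodicOrbit next d₁, ∀ e ∈ Function.periodicOrbit next d₁,
      G.src d = G.src e → d = e := by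
    intro d hd e he h
    rw [← hsrc d hd, ← hsrc e he, h]
  refine ⟨⟨Function.periodicOrbit next d₁, ⟨?_, ?_, ?_⟩, next, d₁, (hmem d₁).2 ⟨0, rfl⟩, hnm,
    fun d hd => (hnext d (hPmem d hd)).2,
    fun d hd e he h => (Function.bijOn_periodicPts next).injOn (hperiodic d hd) (hperiodic e he) h,
    hsurj, fun d hd => (hmem d).1 hd, hsinj,
    fun d hd hd' => hrev d (hPmem d hd) (hPmem _ hd')⟩, hPmem⟩
  · rw [Ne, Function.periodicOrbit_eq_nil_iff_not_periodic_pt]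
    exact not_not.2 hper
  · rw [Function.periodicOrbit_chain' _ hper]
    intro n
    rw [Function.iterate_succ_apply']
    exact ((hnext _ (hit n _ hd₁)).2).symm
  · have hnd := Function.nodup_periodicOrbit (f := next) (x := d₁)
    generalize Function.periodicOrbit next d₁ = c at hnd hsinj
    induction c using Cycle.induction_on with
    | nil => simp
    | cons a l _ =>
      rw [Cycle.map_coe, Cycle.nodup_coe_iff]
      rw [Cycle.nodup_coe_iff] at hnd
      exact hnd.map_on fun x hx y hy h => hsinj x hx y hy h

namespace DirectedLoop

variable {G : TorusGraph V D} (L : G.DirectedLoop)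

open Classical in
/-- The unit flow along a loop. -/
noncomputable def flow (d : D) : ℝ :=
  (if d ∈ L.cycle then 1 else 0) - if G.rev d ∈ L.cycle then 1 else 0

lemma flow_of_mem {d : D} (hd : d ∈ L.cycle) : L.flow d = 1 := by
  rw [flow, if_pos hd, if_neg (L.rev_notMem d hd), sub_zero]

lemma flow_rev (d : D) : L.flow (G.rev d) = -L.flow d := by
  rw [flow, flow, G.rev_rev]; ring

lemma flow_of_rev_mem {d : D} (hd : G.rev d ∈ L.cycle) : L.flow d = -1 := by
  rw [← neg_eq_iff_eq_neg, ← L.flow_rev, L.flow_of_mem hd]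

lemma mem_of_flow_ne_zero {d : D} (hd : L.flow d ≠ 0) : d ∈ L.cycle ∨ G.rev d ∈ L.cycle := by
  by_contra! h
  apply hd
  rw [flow, if_neg h.1, if_neg h.2, sub_zero]

lemma flow_of_notMem {d : D} (h1 : d ∉ L.cycle) (h2 : G.rev d ∉ L.cycle) : L.flow d = 0 := by
  rw [flow, if_neg h1, if_neg h2, sub_zero]

lemma flow_eq_one_iff {d : D} : L.flow d = 1 ↔ d ∈ L.cycle := by
  refine ⟨fun h => ?_, L.flow_of_mem⟩
  rcases L.mem_of_flow_ne_zero (h ▸ one_ne_zero) with hd | hd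
  · exact hd
  · rw [L.flow_of_rev_mem hd] at h
    norm_num at h

lemma flow_cases (d : D) : L.flow d = 0 ∨ L.flow d = 1 ∨ L.flow d = -1 := by
  by_cases h : L.flow d = 0
  · exact Or.inl h
  · rcases L.mem_of_flow_ne_zero h with hd | hd
    · exact Or.inr (Or.inl (L.flow_of_mem hd))
    · exact Or.inr (Or.inr (L.flow_of_rev_mem hd))

/-- `next` is a bijection from the loop edges ending at `v` to the loop edges starting at `v`. -/
lemma flow_isFlow [Fintype D] [DecidableEq V] : G.IsFlow L.flow := by
  classical
  refine ⟨L.flow_rev, fun v => ?_⟩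
  simp only [flow]
  rw [Finset.sum_sub_distrib, sub_eq_zero]
  have e : ∑ d with G.src d = v, (if G.rev d ∈ L.cycle then (1 : ℝ) else 0)
      = ∑ d with G.tgt d = v, if d ∈ L.cycle then (1 : ℝ) else 0 := by
    rw [Finset.sum_filter, Finset.sum_filter, ← G.sum_comp_rev]
    simp only [G.rev_rev]
    rfl
  rw [e, ← Finset.sum_filter, ← Finset.sum_filter]
  symm
  refine Finset.sum_nbij L.next ?_ ?_ ?_ ?_
  · intro d hd
    simp only [Finset.mem_filter, Finset.mem_univ, true_and] at hd ⊢
    exact ⟨by rw [L.src_next d hd.2, hd.1], L.next_mem d hd.2⟩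
  · intro d hd e he h
    simp only [Finset.coe_filter, Finset.mem_filter, Finset.mem_univ, true_and,
      Set.mem_ofPred_eq] at hd he
    exact L.next_inj d hd.2 e he.2 h
  · intro e he
    simp only [Finset.coe_filter, Finset.mem_filter, Finset.mem_univ, true_and,
      Set.mem_ofPred_eq] at he
    obtain ⟨d, hd, rfl⟩ := L.next_surj e he.2
    refine ⟨d, ?_, rfl⟩
    simp only [Finset.coe_filter, Finset.mem_filter, Finset.mem_univ, true_and,
      Set.mem_ofPred_eq]
    exact ⟨by rw [← L.src_next d hd, he.1], hd⟩
  · intro d _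
    rfl

lemma inflow_flow_le [Fintype D] [DecidableEq V] (v : V) : G.inflow L.flow v ≤ 1 := by
  classical
  rw [L.flow_isFlow.inflow_eq]
  have : ∀ d, max (L.flow d) 0 = if d ∈ L.cycle then 1 else 0 := by
    intro d
    split_ifs with h
    · rw [L.flow_of_mem h, max_eq_left zero_le_one]
    · rcases L.flow_cases d with h1 | h1 | h1
      · rw [h1, max_self]
      · exact absurd (L.flow_eq_one_iff.1 h1) h
      · rw [h1, max_eq_right (by norm_num)]
  simp only [this]
  rw [← Finset.sum_filter, Finset.sum_const, nsmul_eq_mul, mul_one]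
  have : ((Finset.univ.filter fun d => G.src d = v).filter fun d => d ∈ L.cycle).card ≤ 1 := by
    rw [Finset.card_le_one]
    intro d hd e he
    simp only [Finset.mem_filter, Finset.mem_univ, true_and] at hd he
    exact L.src_inj d hd.2 e he.2 (hd.1.trans he.1.symm)
  exact_mod_cast this

/-- A flow supported on a loop is a multiple of the unit flow along it. -/
lemma eq_smul_flow [Fintype D] [DecidableEq V] {η : D → ℝ} (hη : G.IsFlow η)
    (hs : ∀ d, η d ≠ 0 → L.flow d ≠ 0) (d : D) : η d = η L.start * L.flow d := by
  have hstep : ∀ d ∈ L.cycle, η (L.next d) = η d := by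
    intro d hd
    have h := hη.2 (G.tgt d)
    -- At the end of `d` the only outgoing edges that can carry flow are `next d` and the reverse of
    -- `d`, so conservation makes the values on `d` and `next d` equal.
    rw [Finset.sum_eq_add (L.next d) (G.rev d)] at h
    · rw [hη.1] at h; linarith
    · intro h'
      exact L.rev_notMem d hd (h' ▸ L.next_mem d hd)
    · intro e he hne
      have he' : G.src e = G.tgt d := (Finset.mem_filter.1 he).2
      by_contra h0
      rcases L.mem_of_flow_ne_zero (hs e h0) with h1 | h1
      · exact hne.1 (L.src_inj e h1 _ (L.next_mem d hd) (by rw [L.src_next d hd, he']))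
      · have h2 := L.src_inj _ (L.next_mem _ h1) _ (L.next_mem d hd)
          (by rw [L.src_next d hd, L.src_next _ h1, tgt_rev, he'])
        have h3 := L.next_inj _ h1 _ hd h2
        exact hne.2 (by rw [← h3, G.rev_rev])
    · intro h'
      exact absurd (by simpa using L.src_next d hd) h'
    · intro h'
      exact (h' (by
        simp only [Finset.mem_filter, Finset.mem_univ, true_and]
        rfl)).elim
  have hc : ∀ n, L.next^[n] L.start ∈ L.cycle ∧ η (L.next^[n] L.start) = η L.start := by
    intro n
    induction n with
    | zero => exact ⟨L.start_mem, rfl⟩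
    | succ n ih =>
      rw [Function.iterate_succ_apply']
      exact ⟨L.next_mem _ ih.1, by rw [hstep _ ih.1, ih.2]⟩
  have hconst : ∀ d ∈ L.cycle, η d = η L.start := by
    intro d hd
    obtain ⟨n, rfl⟩ := L.reach d hd
    exact (hc n).2
  by_cases h1 : d ∈ L.cycle
  · rw [hconst d h1, L.flow_of_mem h1, mul_one]
  by_cases h2 : G.rev d ∈ L.cycle
  · have := hconst _ h2
    rw [hη.1] at this
    rw [L.flow_of_rev_mem h2]
    linarith
  · have h3 := L.flow_of_notMem h1 h2
    rw [h3, mul_zero]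
    by_contra h0
    exact hs d h0 h3

-- Both orientations of an edge contribute equally. For integral `w` the sum is thus an even
-- integer, which makes the multiplicity of a loop's class an integer.
open Classical in
lemma sum_flow_mul [Fintype D] {w : D → ℝ} (hw : ∀ d, w (G.rev d) = -w d) :
    ∑ d, L.flow d * w d = 2 * ∑ d with d ∈ L.cycle, w d := by
  have e : ∑ d, (if G.rev d ∈ L.cycle then (1 : ℝ) else 0) * w d
      = -∑ d, (if d ∈ L.cycle then (1 : ℝ) else 0) * w d := by
    rw [← G.sum_comp_rev, ← Finset.sum_neg_distrib]
    simp only [G.rev_rev, hw, mul_neg]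
  simp only [flow, sub_mul, Finset.sum_sub_distrib]
  rw [e]
  simp only [ite_mul, one_mul, zero_mul]
  rw [← Finset.sum_filter]
  ring

end DirectedLoop

/-- A flow with values in `{0, 1, -1}` and positive weight runs along a loop of positive
weight. -/
lemma exists_loop_pos [Fintype D] [DecidableEq V] (G : TorusGraph V D) (w : D → ℝ) {ω : D → ℝ}
    (hω : G.IsFlow ω) (hv : ∀ d, ω d = 0 ∨ ω d = 1 ∨ ω d = -1) (hpos : 0 < ∑ d, ω d * w d) :
    ∃ L : G.DirectedLoop, (∀ d ∈ L.cycle, ω d = 1) ∧ 0 < ∑ d, L.flow d * w d := by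
  classical
  induction hn : (Finset.univ.filter fun d => ω d = 1).card using Nat.strong_induction_on
    generalizing ω with
  | _ n ih =>
    have hne : {d | ω d = 1}.Nonempty := by
      obtain ⟨d, -, hd⟩ := Finset.exists_ne_zero_of_sum_ne_zero hpos.ne'
      rcases hv d with h | h | h
      · simp [h] at hd
      · exact ⟨d, h⟩
      · exact ⟨G.rev d, by simp [hω.1, h]⟩
    obtain ⟨L, hL⟩ := G.exists_directedLoop {d | ω d = 1} hne
      (by
        intro d hd hd'
        rw [Set.mem_ofPred_eq] at hd hd'
        rw [hω.1, hd] at hd'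
        norm_num at hd')
      (by
        intro d hd
        rw [Set.mem_ofPred_eq] at hd
        by_contra! hc
        have h := hω.2 (G.tgt d)
        have hlt : ∑ e with G.src e = G.tgt d, ω e < 0 := by
          refine Finset.sum_neg' (fun e he => ?_) ⟨G.rev d, ?_, ?_⟩
          · rcases hv e with h | h | h
            · exact h.le
            · exact absurd (Finset.mem_filter.1 he).2 (hc e h)
            · rw [h]; norm_num
          · exact Finset.mem_filter.2 ⟨Finset.mem_univ _, rfl⟩
          · rw [hω.1, hd]; norm_num
        linarith)
    have hL1 : ∀ d ∈ L.cycle, ω d = 1 := hL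
    -- A loop of nonpositive weight is subtracted: the total weight stays positive and fewer edges
    -- have value 1.
    by_cases hp : 0 < ∑ d, L.flow d * w d
    · exact ⟨L, hL1, hp⟩
    have hval : ∀ d, ω d - L.flow d = 0 ∨ (ω d - L.flow d = ω d ∧ d ∉ L.cycle) := by
      intro d
      by_cases h1 : d ∈ L.cycle
      · left; rw [hL1 d h1, L.flow_of_mem h1, sub_self]
      by_cases h2 : G.rev d ∈ L.cycle
      · left
        have := hL1 _ h2
        rw [hω.1] at this
        rw [L.flow_of_rev_mem h2]; linarith
      · right
        rw [L.flow_of_notMem h1 h2, sub_zero]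
        exact ⟨rfl, h1⟩
    have hsub : ∀ d, ω d - L.flow d = 1 → ω d = 1 ∧ d ∉ L.cycle := by
      intro d hd
      rcases hval d with h | h
      · rw [h] at hd; norm_num at hd
      · exact ⟨h.1 ▸ hd, h.2⟩
    obtain ⟨L', hL', hp'⟩ := ih (Finset.univ.filter fun d => ω d - L.flow d = 1).card
      (by
        rw [← hn]
        refine Finset.card_lt_card (Finset.ssubset_iff_subset_ne.2 ⟨fun d hd => ?_, fun h => ?_⟩)
        · simp only [Finset.mem_filter, Finset.mem_univ, true_and] at hd ⊢
          exact (hsub d hd).1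
        · have hm : L.start ∈ Finset.univ.filter fun d => ω d = 1 := by
            simpa using hL1 _ L.start_mem
          rw [← h] at hm
          exact (hsub _ (Finset.mem_filter.1 hm).2).2 L.start_mem)
      (ω := fun d => ω d - L.flow d)
      ⟨fun d => by simp only [hω.1, L.flow_rev]; ring, fun v => by
        rw [Finset.sum_sub_distrib, hω.2, L.flow_isFlow.2, sub_zero]⟩
      (fun d => by
        rcases hval d with h | h
        · exact Or.inl h
        · rw [h.1]; exact hv d)
      (by
        simp only [sub_mul, Finset.sum_sub_distrib]
        linarith)
      rfl
    exact ⟨L', fun d hd => (hsub d (hL' d hd)).1, hp'⟩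

end TorusGraph

/-! ### Grid models from neighbourhoods -/

namespace TorusGraph

open SquareGrid

variable {V D : Type*}

/-- A walk into `S` starts with a walk that avoids `S` and is one step away from `S`. -/
lemma exists_first_entry {α : Type*} {r : α → α → Prop} {S : Set α} {x y : α}
    (h : Relation.ReflTransGen r x y) (hx : x ∉ S) (hy : y ∈ S) :
    ∃ p p', Relation.ReflTransGen (fun a b => r a b ∧ b ∉ S) x p ∧ r p p' ∧ p' ∈ S := by
  have key : ∀ z, Relation.ReflTransGen r x z →
      Relation.ReflTransGen (fun a b => r a b ∧ b ∉ S) x z ∨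
      ∃ p p', Relation.ReflTransGen (fun a b => r a b ∧ b ∉ S) x p ∧ r p p' ∧ p' ∈ S := by
    intro z hz
    induction hz with
    | refl => exact Or.inl .refl
    | @tail b c _ hbc ih =>
      rcases ih with ih | ih
      · by_cases hc : c ∈ S
        · exact Or.inr ⟨b, c, ih, hbc, hc⟩
        · exact Or.inl (ih.tail ⟨hbc, hc⟩)
      · exact Or.inr ih
  rcases key y h with h | h
  · rcases h.cases_tail with h | ⟨b, -, h⟩
    · exact absurd (h ▸ hy) hx
    · exact absurd hy h.2
  · exact h

/-- A grid model from neighbourhoods `U v` of the vertices and `W d` of the truncated edges: the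
blob of `v` consists of `U v` and of the edges starting at `v`, up to the neighbourhood of their
ends. -/
lemma gridModel_of_neighborhoods [Finite V] [Finite D] (G : TorusGraph V D) (N : ℕ) (hN : 0 < N)
    (shift : D → ℤ × ℤ)
    (hdisp : ∀ d, G.displacement d = G.pos (G.tgt d) - G.pos (G.src d) + latticeVec (shift d))
    (hshift : ∀ d, shift (G.rev d) = -shift d)
    (R : Set D) (hR : ∀ d, d ∈ R ↔ G.rev d ∉ R)
    (U : V → Set (ℤ × ℤ)) (W : D → Set (ℤ × ℤ)) (hUf : ∀ v, (U v).Finite)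
    (hWf : ∀ d, (W d).Finite) (c : V → ℤ × ℤ) (hc : ∀ v, c v ∈ U v)
    (hU : ∀ v, ∀ x ∈ U v,
      Relation.ReflTransGen (fun y z => z ∈ U v ∧ ∃ q, z = y + step q) (c v) x)
    (hUU : ∀ v w x a, x ∈ U v → x + (N : ℤ) • a ∈ U w → v = w ∧ a = 0)
    (hUU' : ∀ v w x q a, x ∈ U v → x + step q + (N : ℤ) • a ∈ U w → v = w ∧ a = 0)
    (hWU : ∀ d w x a, x ∈ W d → x - (N : ℤ) • a ∈ U w →
      (w = G.src d ∧ a = 0) ∨ (w = G.tgt d ∧ a = shift d))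
    (hWW : ∀ d ∈ R, ∀ e ∈ R, ∀ x a, x ∈ W d → x + (N : ℤ) • a ∈ W e → d = e ∧ a = 0)
    (hW : ∀ d, ∃ x y, x ∈ U (G.src d) ∧ y - (N : ℤ) • shift d ∈ U (G.tgt d) ∧ x ∈ W d ∧
      Relation.ReflTransGen (fun y z => z ∈ W d ∧ ∃ q, z = y + step q) x y) :
    Nonempty (GridModel G) := by
  classical
  let Ess : D → Prop := fun d => G.src d ≠ G.tgt d ∨ shift d ≠ 0
  have hEss : ∀ d, Ess d → ¬(G.src d = G.tgt d ∧ -shift d = 0) := by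
    rintro d hd ⟨h1, h2⟩
    rcases hd with hd | hd
    · exact hd h1
    · exact hd (neg_eq_zero.1 h2)
  choose s t hs ht hsW hst using hW
  -- `S d` is the neighbourhood of the far end of the lifted edge. `Q d` is the part of the tube `W
  -- d` reached from the near end before entering `S d`; the step from `p d` in direction `q d`
  -- enters `S d` and becomes the grid edge of `d`.
  let S : D → Set (ℤ × ℤ) := fun d => {x | x - (N : ℤ) • shift d ∈ U (G.tgt d)}
  let Q : D → Set (ℤ × ℤ) := fun d => {y | Relation.ReflTransGen
    (fun y z => (z ∈ W d ∧ ∃ q, z = y + step q) ∧ z ∉ S d) (s d) y}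
  have hsS : ∀ d, Ess d → s d ∉ S d := by
    intro d hd h
    refine hEss d hd (hUU _ _ _ (-shift d) (hs d) ?_)
    rwa [smul_neg, ← sub_eq_add_neg]
  have hQ : ∀ d, Ess d → ∀ x ∈ Q d, x ∈ W d ∧ x ∉ S d := by
    intro d hd x hx
    rcases Relation.ReflTransGen.cases_tail hx with h | ⟨b, -, h⟩
    · rw [h]
      exact ⟨hsW d, hsS d hd⟩
    · exact ⟨h.1.1, h.2⟩
  have hexit : ∀ d, ∃ p q, Ess d → p ∈ Q d ∧ p + step q ∈ S d := by
    intro d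
    by_cases hd : Ess d
    · obtain ⟨p, p', h1, ⟨-, q, rfl⟩, h3⟩ := exists_first_entry (hst d) (hsS d hd) (ht d)
      exact ⟨p, q, fun _ => ⟨h1, h3⟩⟩
    · exact ⟨0, 0, fun h => absurd h hd⟩
  choose p q hpq using hexit
  have hpU : ∀ d, Ess d → p d ∉ U (G.src d) := by
    intro d hd h
    refine hEss d hd (hUU' _ _ _ (q d) (-shift d) h ?_)
    rw [smul_neg, ← sub_eq_add_neg]
    exact (hpq d hd).2
  -- Only one orientation of each edge, the one in `R`, contributes its tube, so no tube is shared
  -- by two blobs.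
  let B : V → Set (ℤ × ℤ) := fun v => U v ∪ ⋃ d, {x | d ∈ R ∧ Ess d ∧ G.src d = v ∧ x ∈ Q d}
  have hB : ∀ v x, x ∈ B v ↔ x ∈ U v ∨ ∃ d, d ∈ R ∧ Ess d ∧ G.src d = v ∧ x ∈ Q d := by
    intro v x
    simp only [B, Set.mem_union, Set.mem_iUnion, Set.mem_ofPred_eq]
  have hBf : ∀ v, (B v).Finite := by
    intro v
    refine (hUf v).union (Set.finite_iUnion fun d => ?_)
    exact (hWf d).subset fun x hx => (hQ d hx.2.1 x hx.2.2.2).1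
  have hess_rev : ∀ d, Ess (G.rev d) ↔ Ess d := by
    intro d
    simp only [Ess]
    rw [tgt_rev, hshift, neg_ne_zero, ne_comm]
    rfl
  have hRrev : ∀ d, d ∉ R → G.rev d ∈ R := by
    intro d hd
    by_contra h
    exact hd ((hR d).2 h)
  have hUQ : ∀ v x a e, Ess e → x ∈ U v → x + (N : ℤ) • a ∈ Q e → v = G.src e ∧ a = 0 := by
    intro v x a e he hx hxe
    have h := hQ e he _ hxe
    rcases hWU e v _ a h.1 (by rwa [add_sub_cancel_right]) with h' | ⟨rfl, rfl⟩
    · exact h'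
    · refine absurd ?_ h.2
      change _ ∈ U _
      rwa [add_sub_cancel_right]
  -- The base of an edge in `R` lies outside all neighbourhoods `U`, whereas the base of an edge not
  -- in `R` lies inside one. This separates the two kinds in the proof that grid edges are distinct.
  have hpRU : ∀ d, Ess d → ∀ v a, p d - (N : ℤ) • a ∉ U v := by
    intro d hd v a h
    obtain ⟨rfl, rfl⟩ := hUQ v _ a d hd h (by rw [sub_add_cancel]; exact (hpq d hd).1)
    exact hpU d hd (by simpa using h)
  let base : D → ℤ × ℤ := fun d =>
    if d ∈ R then p d else p (G.rev d) + step (q (G.rev d)) - (N : ℤ) • shift (G.rev d)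
  let dir : D → Fin 4 := fun d => if d ∈ R then q d else q (G.rev d) + 2
  have hbase_notR : ∀ d, Ess d → d ∉ R → base d ∈ U (G.src d) := by
    intro d hd hdR
    simp only [base, if_neg hdR]
    have := (hpq (G.rev d) ((hess_rev d).2 hd)).2
    change _ - _ ∈ U (G.tgt (G.rev d)) at this
    rwa [tgt_rev] at this
  refine ⟨⟨N, hN, shift, hdisp, hshift, fun v => (hBf v).toFinset, ?_, ?_, base, dir,
    ?_, ?_, ?_, ?_⟩⟩
  · intro v
    have hUr : ∀ x ∈ U v, Relation.ReflTransGen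
        (fun y z => z ∈ (hBf v).toFinset ∧ ∃ q, z = y + step q) (c v) x := by
      intro x hx
      have h := hU v x hx
      clear hx
      induction h with
      | refl => exact .refl
      | @tail y z _ h ih =>
        refine ih.tail ⟨?_, h.2⟩
        rw [Set.Finite.mem_toFinset, hB]
        exact Or.inl h.1
    refine GridTree.of_reachable (x₀ := c v) ?_ ?_
    · rw [Set.Finite.mem_toFinset, hB]
      exact Or.inl (hc v)
    · intro x hx
      rw [Set.Finite.mem_toFinset, hB] at hx
      rcases hx with hx | ⟨d, hdR, hd, rfl, hx⟩
      · exact hUr x hx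
      · change Relation.ReflTransGen _ _ _ at hx
        induction hx with
        | refl => exact hUr _ (hs d)
        | @tail y z hxy hyz ih =>
          refine ih.tail ⟨?_, hyz.1.2⟩
          rw [Set.Finite.mem_toFinset, hB]
          exact Or.inr ⟨d, hdR, hd, rfl, hxy.tail hyz⟩
  · intro v w x a hx hxa
    rw [Set.Finite.mem_toFinset, hB] at hx hxa
    rcases hx with hx | ⟨d, hdR, hd, rfl, hx⟩ <;> rcases hxa with hxa | ⟨e, heR, he, rfl, hxa⟩
    · exact hUU v w x a hx hxa
    · exact hUQ v x a e he hx hxa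
    · obtain ⟨h1, h2⟩ := hUQ w _ (-a) d hd hxa (by rwa [smul_neg, add_neg_cancel_right])
      exact ⟨h1.symm, neg_eq_zero.1 h2⟩
    · obtain ⟨rfl, h⟩ := hWW d hdR e heR x a (hQ d hd x hx).1 (hQ e he _ hxa).1
      exact ⟨rfl, h⟩
  · intro d hd
    rw [Set.Finite.mem_toFinset, hB]
    by_cases hdR : d ∈ R
    · refine Or.inr ⟨d, hdR, hd, rfl, ?_⟩
      simp only [base, if_pos hdR]
      exact (hpq d hd).1
    · exact Or.inl (hbase_notR d hd hdR)
  · intro d hd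
    by_cases hdR : d ∈ R
    · have h' := (hR d).1 hdR
      simp only [base, dir, if_pos hdR, if_neg h', G.rev_rev]
    · have h' := hRrev d hdR
      simp only [base, dir, if_pos h', if_neg hdR, hshift, smul_neg]
      rw [sub_neg_eq_add, add_right_comm, add_sub_cancel_right, add_step_rev]
  · intro d hd
    by_cases hdR : d ∈ R
    · have h' := (hR d).1 hdR
      simp only [dir, if_pos hdR, if_neg h', G.rev_rev]
    · have h' := hRrev d hdR
      simp only [dir, if_pos h', if_neg hdR, dir_rev_rev]
  · intro d e hd he hb hdir
    by_cases hdR : d ∈ R <;> by_cases heR : e ∈ R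
    · simp only [base, if_pos hdR, if_pos heR] at hb
      refine (hWW d hdR e heR (p d) 0 (hQ d hd _ (hpq d hd).1).1 ?_).1
      rw [smul_zero, add_zero, hb]
      exact (hQ e he _ (hpq e he).1).1
    · have h := hbase_notR e he heR
      rw [← hb] at h
      simp only [base, if_pos hdR] at h
      exact absurd (by simpa using h) (hpRU d hd (G.src e) 0)
    · have h := hbase_notR d hd hdR
      rw [hb] at h
      simp only [base, if_pos heR] at h
      exact absurd (by simpa using h) (hpRU e he (G.src d) 0)
    · simp only [base, dir, if_neg hdR, if_neg heR] at hb hdir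
      have hd' := (hess_rev d).2 hd
      have he' := (hess_rev e).2 he
      rw [add_right_cancel hdir] at hb
      have h := (hWW _ (hRrev d hdR) _ (hRrev e heR) (p (G.rev d))
        (shift (G.rev e) - shift (G.rev d)) (hQ _ hd' _ (hpq _ hd').1).1 ?_).1
      · rw [← G.rev_rev d, h, G.rev_rev]
      · have : p (G.rev d) + (N : ℤ) • (shift (G.rev e) - shift (G.rev d)) = p (G.rev e) := by
          rw [smul_sub]
          have h3 := sub_eq_sub_iff_add_eq_add.1 hb
          have h4 : p (G.rev d) + (N : ℤ) • shift (G.rev e)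
              = p (G.rev e) + (N : ℤ) • shift (G.rev d) := by
            apply add_right_cancel (b := step (q (G.rev e)))
            rw [add_right_comm, h3, add_right_comm]
          rw [← add_sub_assoc, h4, add_sub_cancel_right]
        rw [this]
        exact (hQ _ he' _ (hpq _ he').1).1

end TorusGraph

/-! ### Discretizing points and curves of the plane -/

namespace TorusGraph

open SquareGrid Filter Topology

variable {V D : Type*}

lemma latticeVec_add (a b : ℤ × ℤ) : latticeVec (a + b) = latticeVec a + latticeVec b := by
  simp [latticeVec]

lemma latticeVec_neg (a : ℤ × ℤ) : latticeVec (-a) = -latticeVec a := by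
  simp [latticeVec]

lemma latticeVec_sub (a b : ℤ × ℤ) : latticeVec (a - b) = latticeVec a - latticeVec b := by
  simp [latticeVec]

lemma latticeVec_eq_zero {a : ℤ × ℤ} (h : latticeVec a = 0) : a = 0 := by
  simpa [latticeVec, Prod.ext_iff] using h

lemma isClosed_latticeVec_image (S : Set (ℤ × ℤ)) : IsClosed (latticeVec '' S) := by
  refine Metric.isClosed_of_pairwise_le_dist (ε := 1) one_pos ?_
  rintro _ ⟨a, -, rfl⟩ _ ⟨b, -, rfl⟩ hne
  rw [Prod.dist_eq, le_max_iff]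
  simp only [latticeVec, Real.dist_eq]
  by_contra! h
  apply hne
  have key : ∀ m n : ℤ, |(m : ℝ) - n| < 1 → m = n := by
    intro m n hmn
    rw [← Int.cast_sub, ← Int.cast_abs] at hmn
    have : |m - n| < 1 := by exact_mod_cast hmn
    rw [Int.abs_lt_one_iff] at this
    omega
  rw [Prod.ext (key _ _ h.1) (key _ _ h.2)]

/-- Two compact sets are uniformly separated modulo the lattice translations that keep them
disjoint. -/
lemma eventually_separated {K K' : Set (ℝ × ℝ)} (hK : IsCompact K) (hK' : IsCompact K') :
    ∀ᶠ η in 𝓝[>] (0 : ℝ), ∀ k, (∃ x ∈ K, ∃ y ∈ K', ‖x - y - latticeVec k‖ < η) →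
      ∃ x ∈ K, ∃ y ∈ K', x - y = latticeVec k := by
  -- The difference set is compact and the lattice vectors outside it form a closed set, so the two
  -- are a positive distance apart.
  set C : Set (ℝ × ℝ) := (fun z : (ℝ × ℝ) × (ℝ × ℝ) => z.1 - z.2) '' (K ×ˢ K') with hC
  have hCc : IsCompact C := (hK.prod hK').image (by fun_prop)
  have hdisj : Disjoint C (latticeVec '' {k | latticeVec k ∉ C}) := by
    rw [Set.disjoint_right]
    rintro _ ⟨k, hk, rfl⟩
    exact hk
  obtain ⟨δ, hδ, hd⟩ := hdisj.exists_thickenings hCc (isClosed_latticeVec_image _)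
  filter_upwards [Ioo_mem_nhdsGT hδ] with η hη
  rintro k ⟨x, hx, y, hy, hxy⟩
  have hk : latticeVec k ∈ C := by
    by_contra hk
    have h1 : latticeVec k ∈ Metric.thickening δ C := by
      rw [Metric.mem_thickening_iff]
      refine ⟨x - y, ⟨(x, y), ⟨hx, hy⟩, rfl⟩, ?_⟩
      rw [dist_comm, dist_eq_norm]
      exact hxy.trans hη.2
    exact Set.disjoint_left.1 hd h1 (Metric.self_subset_thickening hδ _ ⟨k, hk, rfl⟩)
  obtain ⟨⟨x', y'⟩, ⟨hx', hy'⟩, h⟩ := hk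
  exact ⟨x', hx', y', hy', h⟩

/-- The point of the plane of a grid point, in the grid of mesh `1 / N`. -/
noncomputable def gridPoint (N : ℕ) (x : ℤ × ℤ) : ℝ × ℝ := (x.1 / N, x.2 / N)

/-- The grid point to the lower left of a point of the plane. -/
noncomputable def gridFloor (N : ℕ) (z : ℝ × ℝ) : ℤ × ℤ := (⌊N * z.1⌋, ⌊N * z.2⌋)

variable {N : ℕ}

lemma gridPoint_period (hN : 0 < N) (x a : ℤ × ℤ) :
    gridPoint N (x + (N : ℤ) • a) = gridPoint N x + latticeVec a := by
  have : (N : ℝ) ≠ 0 := Nat.cast_ne_zero.2 hN.ne'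
  ext
  · simp [gridPoint, latticeVec]; field_simp
  · simp [gridPoint, latticeVec]; field_simp

lemma gridPoint_period_sub (hN : 0 < N) (x a : ℤ × ℤ) :
    gridPoint N (x - (N : ℤ) • a) = gridPoint N x - latticeVec a := by
  rw [sub_eq_add_neg, ← smul_neg, gridPoint_period hN, latticeVec_neg, ← sub_eq_add_neg]

lemma norm_le_iff {z : ℝ × ℝ} {r : ℝ} : ‖z‖ ≤ r ↔ |z.1| ≤ r ∧ |z.2| ≤ r := by
  rw [Prod.norm_def, max_le_iff, Real.norm_eq_abs, Real.norm_eq_abs]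

lemma norm_lt_iff {z : ℝ × ℝ} {r : ℝ} : ‖z‖ < r ↔ |z.1| < r ∧ |z.2| < r := by
  rw [Prod.norm_def, max_lt_iff, Real.norm_eq_abs, Real.norm_eq_abs]

lemma norm_gridPoint_step (x : ℤ × ℤ) (q : Fin 4) :
    ‖gridPoint N (x + step q) - gridPoint N x‖ ≤ 1 / N := by
  have e : gridPoint N (x + step q) - gridPoint N x
      = (((step q).1 : ℝ) / N, ((step q).2 : ℝ) / N) := by
    ext <;> simp [gridPoint] <;> ring
  rw [e, norm_le_iff]
  have : ∀ q, |(step q).1| ≤ 1 ∧ |(step q).2| ≤ 1 := by decide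
  obtain ⟨h1, h2⟩ := this q
  have h1' : |((step q).1 : ℝ)| ≤ 1 := by exact_mod_cast h1
  have h2' : |((step q).2 : ℝ)| ≤ 1 := by exact_mod_cast h2
  simp only [abs_div, Nat.abs_cast]
  exact ⟨by gcongr, by gcongr⟩

lemma abs_floor_div_sub_le (hN : 0 < N) (t : ℝ) : |(⌊N * t⌋ : ℝ) / N - t| ≤ 1 / N := by
  have hN' : (0 : ℝ) < N := Nat.cast_pos.2 hN
  have h1 := Int.floor_le (N * t)
  have h2 := Int.lt_floor_add_one (N * t)
  rw [abs_le]
  constructor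
  · rw [← sub_nonneg]
    have : (⌊N * t⌋ : ℝ) / N - t - -(1 / N) = (⌊N * t⌋ + 1 - N * t) / N := by field_simp; ring
    rw [this]
    exact div_nonneg (by linarith) hN'.le
  · rw [← sub_nonneg]
    have : 1 / N - ((⌊N * t⌋ : ℝ) / N - t) = (1 + (N * t - ⌊N * t⌋)) / N := by field_simp; ring
    rw [this]
    exact div_nonneg (by linarith) hN'.le

lemma norm_gridFloor_sub_le (hN : 0 < N) (z : ℝ × ℝ) :
    ‖gridPoint N (gridFloor N z) - z‖ ≤ 1 / N :=
  norm_le_iff.2 ⟨abs_floor_div_sub_le hN z.1, abs_floor_div_sub_le hN z.2⟩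

lemma finite_gridPoint_norm_le (hN : 0 < N) (C : ℝ) : {x | ‖gridPoint N x‖ ≤ C}.Finite := by
  have hN' : (0 : ℝ) < N := Nat.cast_pos.2 hN
  have h1 : ∀ n : ℤ, |(n : ℝ) / N| ≤ C → n ∈ Set.Icc (-⌈C * N⌉) ⌈C * N⌉ := by
    intro n hn
    rw [abs_div, Nat.abs_cast, div_le_iff₀ hN'] at hn
    have h2 := (abs_le.1 hn)
    have h3 := Int.le_ceil (C * N)
    constructor
    · have : ((-⌈C * N⌉ : ℤ) : ℝ) ≤ n := by push_cast; linarith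
      exact_mod_cast this
    · have : (n : ℝ) ≤ ⌈C * N⌉ := by linarith
      exact_mod_cast this
  refine ((Set.finite_Icc (-⌈C * N⌉) ⌈C * N⌉).prod (Set.finite_Icc (-⌈C * N⌉) ⌈C * N⌉)).subset ?_
  intro x hx
  have := norm_le_iff.1 hx
  exact ⟨h1 _ this.1, h1 _ this.2⟩

lemma finite_gridPoint_near (hN : 0 < N) {K : Set (ℝ × ℝ)} (hK : Bornology.IsBounded K) (ε : ℝ) :
    {x | ∃ z ∈ K, ‖gridPoint N x - z‖ ≤ ε}.Finite := by
  obtain ⟨C, hC⟩ := hK.exists_norm_le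
  refine (finite_gridPoint_norm_le hN (ε + C)).subset ?_
  rintro x ⟨z, hz, hxz⟩
  calc ‖gridPoint N x‖ = ‖(gridPoint N x - z) + z‖ := by rw [sub_add_cancel]
    _ ≤ ‖gridPoint N x - z‖ + ‖z‖ := norm_add_le _ _
    _ ≤ ε + C := add_le_add hxz (hC z hz)

/-- A box of grid points is connected. -/
lemma box_reachable (hN : 0 < N) {z : ℝ × ℝ} {r : ℝ} (hr : 1 / N < r) (x : ℤ × ℤ)
    (hx : ‖gridPoint N x - z‖ < r) :
    Relation.ReflTransGen (fun y w => ‖gridPoint N w - z‖ < r ∧ ∃ q, w = y + step q)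
      (gridFloor N z) x := by
  have hN' : (0 : ℝ) < N := Nat.cast_pos.2 hN
  -- A coordinate step towards `gridFloor` stays in the box. The floor may lie up to `1 / N` below
  -- the centre, hence the condition `1 / N < r`.
  have down : ∀ (n : ℤ) (t : ℝ), |(n : ℝ) / N - t| < r → ⌊N * t⌋ < n →
      |((n - 1 : ℤ) : ℝ) / N - t| < r := by
    intro n t h1 h2
    have h3 : N * t < n := Int.floor_lt.1 h2
    have h4 : (⌊N * t⌋ : ℝ) ≤ n - 1 := by
      have : ⌊N * t⌋ ≤ n - 1 := by omega
      exact_mod_cast this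
    have h5 := (abs_le.1 (abs_floor_div_sub_le hN t)).1
    have h6 : (⌊N * t⌋ : ℝ) / N ≤ (n - 1) / N := by gcongr
    have h7 : ((n : ℝ) - 1) / N ≤ n / N := by gcongr; linarith
    push_cast
    rw [abs_lt] at h1 ⊢
    constructor <;> linarith
  have up : ∀ (n : ℤ) (t : ℝ), |(n : ℝ) / N - t| < r → n < ⌊N * t⌋ →
      |((n + 1 : ℤ) : ℝ) / N - t| < r := by
    intro n t h1 h2
    have h4 : (n : ℝ) + 1 ≤ ⌊N * t⌋ := by exact_mod_cast h2
    have h5 := Int.floor_le (N * t)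
    have h6 : ((n : ℝ) + 1) / N ≤ t := by
      rw [div_le_iff₀ hN']; linarith
    have h7 : (n : ℝ) / N ≤ (n + 1) / N := by gcongr; linarith
    push_cast
    rw [abs_lt] at h1 ⊢
    have : (0 : ℝ) < 1 / N := by positivity
    constructor <;> linarith
  induction hn : (x.1 - (gridFloor N z).1).natAbs + (x.2 - (gridFloor N z).2).natAbs
    using Nat.strong_induction_on generalizing x with
  | _ n ih =>
    have move : ∀ q, ‖gridPoint N (x + step q) - z‖ < r →
        ((x + step q).1 - (gridFloor N z).1).natAbs
          + ((x + step q).2 - (gridFloor N z).2).natAbs < n →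
        Relation.ReflTransGen (fun y w => ‖gridPoint N w - z‖ < r ∧ ∃ q, w = y + step q)
          (gridFloor N z) x := by
      intro q h1 h2
      exact (ih _ h2 (x + step q) h1 rfl).tail ⟨hx, q + 2, (add_step_rev x q).symm⟩
    obtain ⟨a, b⟩ := x
    have hx' := norm_lt_iff.1 hx
    simp only [gridPoint, Prod.fst_sub, Prod.snd_sub] at hx'
    simp only [gridFloor] at hn move ⊢
    rcases lt_trichotomy a ⌊N * z.1⌋ with h | h | h
    · refine move 0 (norm_lt_iff.2 ?_) ?_
      · simpa [gridPoint, step] using ⟨by simpa using up a z.1 hx'.1 h, hx'.2⟩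
      · simp [step]; omega
    · rcases lt_trichotomy b ⌊N * z.2⌋ with h' | h' | h'
      · refine move 1 (norm_lt_iff.2 ?_) ?_
        · simpa [gridPoint, step] using ⟨hx'.1, by simpa using up b z.2 hx'.2 h'⟩
        · simp [step]; omega
      · rw [h, h']
      · refine move 3 (norm_lt_iff.2 ?_) ?_
        · have := down b z.2 hx'.2 h'
          push_cast at this
          simpa [gridPoint, step, ← sub_eq_add_neg] using ⟨hx'.1, this⟩
        · simp [step]; omega
    · refine move 2 (norm_lt_iff.2 ?_) ?_
      · have := down a z.1 hx'.1 h
        push_cast at this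
        simpa [gridPoint, step, ← sub_eq_add_neg] using ⟨this, hx'.2⟩
      · simp [step]; omega

/-- The grid points along two nearby points of the plane are connected near one of them. -/
lemma gridFloor_reachable (hN : 0 < N) {z w : ℝ × ℝ} (hzw : ‖z - w‖ < 1 / N) {S : Set (ℤ × ℤ)}
    (hS : ∀ x, ‖gridPoint N x - z‖ ≤ 2 / N → x ∈ S) :
    Relation.ReflTransGen (fun y x => x ∈ S ∧ ∃ q, x = y + step q)
      (gridFloor N z) (gridFloor N w) := by
  have hN' : (0 : ℝ) < N := Nat.cast_pos.2 hN
  have h2N : (2 : ℝ) / N = 1 / N + 1 / N := by ring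
  have hpos : (0 : ℝ) < 1 / N := by positivity
  have near : ∀ t u : ℝ, |t - u| < 1 / N → |⌊N * t⌋ - ⌊N * u⌋| ≤ 1 := by
    intro t u h
    rw [lt_div_iff₀ hN', ← abs_of_pos hN', ← abs_mul, sub_mul, abs_lt] at h
    have f1 := Int.floor_le (N * t)
    have f2 := Int.lt_floor_add_one (N * t)
    have f3 := Int.floor_le (N * u)
    have f4 := Int.lt_floor_add_one (N * u)
    have g1 : (⌊N * t⌋ : ℝ) < ⌊N * u⌋ + 2 := by linarith
    have g2 : (⌊N * u⌋ : ℝ) < ⌊N * t⌋ + 2 := by linarith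
    have g1' : ⌊N * t⌋ < ⌊N * u⌋ + 2 := by exact_mod_cast g1
    have g2' : ⌊N * u⌋ < ⌊N * t⌋ + 2 := by exact_mod_cast g2
    rw [abs_le]
    omega
  have hzw' := norm_lt_iff.1 hzw
  simp only [Prod.fst_sub, Prod.snd_sub] at hzw'
  have far : ∀ t u : ℝ, |t - u| < 1 / N → |(⌊N * u⌋ : ℝ) / N - t| ≤ 2 / N := by
    intro t u h
    have := abs_le.1 (abs_floor_div_sub_le hN u)
    rw [abs_lt] at h
    rw [abs_le, h2N]
    constructor <;> linarith
  have close : ∀ t : ℝ, |(⌊N * t⌋ : ℝ) / N - t| ≤ 2 / N := fun t =>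
    (abs_floor_div_sub_le hN t).trans (by rw [h2N]; linarith)
  have horizontal : ∀ a a' b : ℤ, |a - a'| ≤ 1 → (a', b) ∈ S →
      Relation.ReflTransGen (fun y x => x ∈ S ∧ ∃ q, x = y + step q) (a, b) (a', b) := by
    intro a a' b h hm
    rw [abs_le] at h
    obtain h | h | h : a' = a ∨ a' = a + 1 ∨ a' = a - 1 := by omega
    · rw [h]
    · exact .single ⟨hm, 0, by simp [step, h]⟩
    · exact .single ⟨hm, 2, by simp [step, h, sub_eq_add_neg]⟩
  have vertical : ∀ a b b' : ℤ, |b - b'| ≤ 1 → (a, b') ∈ S →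
      Relation.ReflTransGen (fun y x => x ∈ S ∧ ∃ q, x = y + step q) (a, b) (a, b') := by
    intro a b b' h hm
    rw [abs_le] at h
    obtain h | h | h : b' = b ∨ b' = b + 1 ∨ b' = b - 1 := by omega
    · rw [h]
    · exact .single ⟨hm, 1, by simp [step, h]⟩
    · exact .single ⟨hm, 3, by simp [step, h, sub_eq_add_neg]⟩
  refine (horizontal _ ⌊N * w.1⌋ _ (near _ _ hzw'.1) (hS _ ?_)).trans
    (vertical _ _ _ (near _ _ hzw'.2) (hS _ ?_))
  · exact norm_le_iff.2 ⟨far _ _ hzw'.1, close z.2⟩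
  · exact norm_le_iff.2 ⟨far _ _ hzw'.1, far _ _ hzw'.2⟩

/-- The grid points near a connected piece of a curve are connected. -/
lemma curve_reachable (hN : 0 < N) {γ : ℝ → ℝ × ℝ} (hγ : Continuous γ) {J : Set ℝ}
    (hJ : IsPreconnected J) {s t : ℝ} (hs : s ∈ J) (ht : t ∈ J) :
    Relation.ReflTransGen
      (fun y x => x ∈ {x | ∃ z ∈ γ '' J, ‖gridPoint N x - z‖ ≤ 2 / N} ∧ ∃ q, x = y + step q)
      (gridFloor N (γ s)) (gridFloor N (γ t)) := by
  set r := fun y x : ℤ × ℤ =>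
    x ∈ {x | ∃ z ∈ γ '' J, ‖gridPoint N x - z‖ ≤ 2 / N} ∧ ∃ q, x = y + step q
  have hN' : (0 : ℝ) < 1 / N := by positivity
  -- Reachability is required in both directions because `r` constrains only the arrival point and
  -- so is not symmetric. The resulting equivalence relation holds locally, hence on all of the
  -- preconnected set `J`.
  refine (hJ.induction₂ (fun s t => Relation.ReflTransGen r (gridFloor N (γ s))
    (gridFloor N (γ t)) ∧ Relation.ReflTransGen r (gridFloor N (γ t)) (gridFloor N (γ s)))
    ?_ ?_ ?_ hs ht).1
  · intro u hu
    have h1 : ∀ᶠ v in 𝓝[J] u, ‖γ u - γ v‖ < 1 / N := by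
      have := (Metric.tendsto_nhds.1 (hγ.tendsto u) _ hN').filter_mono
        (nhdsWithin_le_nhds (s := J))
      filter_upwards [this] with v hv
      rwa [← dist_eq_norm, dist_comm]
    filter_upwards [h1, self_mem_nhdsWithin] with v hv hvJ
    exact ⟨gridFloor_reachable hN hv fun x hx => ⟨_, ⟨u, hu, rfl⟩, hx⟩,
      gridFloor_reachable hN (by rwa [norm_sub_rev]) fun x hx => ⟨_, ⟨v, hvJ, rfl⟩, hx⟩⟩
  · intro a b c _ _ _ h1 h2
    exact ⟨h1.1.trans h2.1, h2.2.trans h1.2⟩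
  · intro a b _ _ h
    exact ⟨h.2, h.1⟩

end TorusGraph

/-! ### Existence of a grid model -/

namespace TorusGraph

open SquareGrid Filter Topology

variable {V D : Type*}

lemma pos_sub_pos (G : TorusGraph V D) {v w : V} {k : ℤ × ℤ}
    (h : G.pos w - G.pos v = latticeVec k) : v = w ∧ k = 0 := by
  have e : v = w := G.pos_inj v w k (by rw [← h, add_sub_cancel])
  subst e
  exact ⟨rfl, latticeVec_eq_zero (by rw [← h, sub_self])⟩

/-- An edge as a curve that starts at the chosen lift of its starting vertex, up to the lattice
vector `k`. -/
noncomputable def curve (G : TorusGraph V D) (k : D → ℤ × ℤ) (d : D) (t : ℝ) : ℝ × ℝ :=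
  G.arc d (Set.projIcc 0 1 zero_le_one t) - latticeVec (k d)

lemma continuous_curve (G : TorusGraph V D) (k : D → ℤ × ℤ) (d : D) :
    Continuous (G.curve k d) :=
  ((G.arc d).continuous.comp continuous_projIcc).sub continuous_const

/-- Number the oriented edges and keep the smaller of each pair of reverses, which are distinct. -/
lemma exists_orientation [Finite D] (G : TorusGraph V D) :
    ∃ R : Set D, ∀ d, d ∈ R ↔ G.rev d ∉ R := by
  obtain ⟨f, hf⟩ := exists_injective_nat D
  refine ⟨{d | f d < f (G.rev d)}, fun d => ?_⟩
  have : f (G.rev d) ≠ f d := fun h => G.rev_ne d (hf h)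
  simp only [Set.mem_ofPred_eq, G.rev_rev]
  omega

/-- Every finite torus graph has a grid model. -/
theorem exists_gridModel [Finite V] [Finite D] (G : TorusGraph V D) : Nonempty (GridModel G) := by
  classical
  choose k hk using G.arc_zero
  obtain ⟨R, hR⟩ := G.exists_orientation
  set γ := G.curve k with hγ
  have hγc : ∀ d, Continuous (γ d) := G.continuous_curve k
  set shift : D → ℤ × ℤ := fun d => k (G.rev d) - k d with hshift
  have harc1 : ∀ d, G.arc d 1 = G.pos (G.tgt d) + latticeVec (k (G.rev d)) := by
    intro d
    have := G.arc_rev d 0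
    rw [unitInterval.symm_zero] at this
    rw [← this, hk (G.rev d)]
    rfl
  have hγ0 : ∀ d, γ d 0 = G.pos (G.src d) := by
    intro d
    simp only [hγ, curve]
    rw [Set.projIcc_left, show (⟨0, _⟩ : I) = 0 from rfl, hk, add_sub_cancel_right]
  have hγ1 : ∀ d, γ d 1 = G.pos (G.tgt d) + latticeVec (shift d) := by
    intro d
    simp only [hγ, curve]
    rw [Set.projIcc_right, show (⟨1, _⟩ : I) = 1 from rfl, harc1, hshift, latticeVec_sub]
    abel
  have hdisp : ∀ d,
      G.displacement d = G.pos (G.tgt d) - G.pos (G.src d) + latticeVec (shift d) := by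
    intro d
    rw [displacement, harc1, hk, hshift, latticeVec_sub]
    abel
  have hcp : ∀ d, ∀ t ∈ Set.Icc (0 : ℝ) 1, ∀ w a, γ d t - G.pos w = latticeVec a →
      (w = G.src d ∧ a = 0) ∨ (w = G.tgt d ∧ a = shift d) := by
    intro d t ht w a h
    rcases ht.1.eq_or_lt with rfl | h0
    · rw [hγ0] at h
      obtain ⟨h1, h2⟩ := G.pos_sub_pos h
      exact Or.inl ⟨h1, h2⟩
    rcases ht.2.eq_or_lt with rfl | h1
    · rw [hγ1] at h
      obtain ⟨h1, h2⟩ := G.pos_sub_pos (v := w) (w := G.tgt d) (k := a - shift d) (by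
        rw [latticeVec_sub, ← h]; abel)
      exact Or.inr ⟨h1, sub_eq_zero.1 h2⟩
    · exfalso
      refine G.arc_ne_pos d (Set.projIcc 0 1 zero_le_one t) ?_ w (a + k d) ?_
      · rw [Set.projIcc_of_mem zero_le_one ht]
        exact ⟨h0, h1⟩
      · rw [latticeVec_add, ← h]
        simp only [hγ, curve]
        abel
  have hcc : ∀ d ∈ R, ∀ e ∈ R, ∀ s ∈ Set.Ioo (0 : ℝ) 1, ∀ t ∈ Set.Ioo (0 : ℝ) 1, ∀ a,
      γ e t - γ d s = latticeVec a → d = e ∧ a = 0 := by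
    intro d hd e he s hs t ht a h
    have hs' : Set.projIcc 0 1 zero_le_one s ∈ Set.Ioo (0 : I) 1 := by
      rw [Set.projIcc_of_mem zero_le_one ⟨hs.1.le, hs.2.le⟩]
      exact hs
    have ht' : Set.projIcc 0 1 zero_le_one t ∈ Set.Ioo (0 : I) 1 := by
      rw [Set.projIcc_of_mem zero_le_one ⟨ht.1.le, ht.2.le⟩]
      exact ht
    have h1 := G.arc_disjoint d e _ hs' _ ht' (a + k e - k d) (by
      rw [latticeVec_sub, latticeVec_add, ← h]
      simp only [hγ, curve]
      abel)
    rcases h1 with ⟨rfl, h2⟩ | ⟨rfl, -⟩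
    · refine ⟨rfl, latticeVec_eq_zero ?_⟩
      rw [← h]
      simp only [hγ, curve, h2, sub_self]
    · exact absurd he ((hR d).1 hd)
  obtain ⟨η, hη⟩ : ∃ η : ℝ, 0 < η ∧
      (∀ v w a, ‖G.pos w - G.pos v - latticeVec a‖ < η → v = w ∧ a = 0) ∧
      ∀ d, ∀ t ∈ Set.Icc (0 : ℝ) 1, ∀ w a, ‖γ d t - G.pos w - latticeVec a‖ < η →
        (w = G.src d ∧ a = 0) ∨ (w = G.tgt d ∧ a = shift d) := by
    have e1 := eventually_all.2 fun v => eventually_all.2 fun w =>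
      eventually_separated (isCompact_singleton (x := G.pos w)) (isCompact_singleton (x := G.pos v))
    have e2 := eventually_all.2 fun d => eventually_all.2 fun w =>
      eventually_separated ((isCompact_Icc (a := (0 : ℝ)) (b := 1)).image (hγc d))
        (isCompact_singleton (x := G.pos w))
    obtain ⟨η, ⟨h1, h2⟩, h3⟩ := ((e1.and e2).and self_mem_nhdsWithin).exists
    refine ⟨η, h3, ?_, ?_⟩
    · intro v w a h
      obtain ⟨_, rfl, _, rfl, h'⟩ := h1 v w a ⟨_, rfl, _, rfl, h⟩
      exact G.pos_sub_pos h'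
    · intro d t ht w a h
      obtain ⟨_, ⟨t', ht', rfl⟩, _, rfl, h'⟩ := h2 d w a ⟨_, ⟨t, ht, rfl⟩, _, rfl, h⟩
      exact hcp d t' ht' w a h'
  obtain ⟨hη0, hη1, hη2⟩ := hη
  -- Two radii `r` plus a grid step, or one radius plus the tube width `2 / N`, must stay below `η`.
  set r := η / 3 with hr
  have hr0 : 0 < r := by positivity
  have hends : ∀ d, ∃ a ∈ Set.Ioo (0 : ℝ) 1, ‖γ d a - G.pos (G.src d)‖ < r / 2 := by
    intro d
    have h1 := (Metric.tendsto_nhds.1 ((hγc d).tendsto 0) (r / 2) (by positivity)).filter_mono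
      (nhdsWithin_le_nhds (s := Set.Ioi 0))
    obtain ⟨a, h2, h3⟩ := (h1.and (Ioo_mem_nhdsGT (zero_lt_one' ℝ))).exists
    rw [hγ0, dist_eq_norm] at h2
    exact ⟨a, h3, h2⟩
  have hends' : ∀ d, ∃ b ∈ Set.Ioo (0 : ℝ) 1,
      ‖γ d b - (G.pos (G.tgt d) + latticeVec (shift d))‖ < r / 2 := by
    intro d
    have h1 := (Metric.tendsto_nhds.1 ((hγc d).tendsto 1) (r / 2) (by positivity)).filter_mono
      (nhdsWithin_le_nhds (s := Set.Iio 1))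
    obtain ⟨a, h2, h3⟩ := (h1.and (Ioo_mem_nhdsLT (zero_lt_one' ℝ))).exists
    rw [hγ1, dist_eq_norm] at h2
    exact ⟨a, h3, h2⟩
  choose a ha haγ using hends
  choose b hb hbγ using hends'
  -- Whole edges may meet at their ends and have no positive distance, so they are truncated inside
  -- the vertex neighbourhoods. The order of `a d` and `b d` is not known, whence the unordered
  -- interval.
  let J : D → Set ℝ := fun d => Set.uIcc (a d) (b d)
  have hJ : ∀ d, ∀ t ∈ J d, t ∈ Set.Ioo (0 : ℝ) 1 := fun d t ht =>
    Set.ordConnected_Ioo.uIcc_subset (ha d) (hb d) ht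
  obtain ⟨ε, hε0, hε⟩ : ∃ ε : ℝ, 0 < ε ∧ ∀ d ∈ R, ∀ e ∈ R, ∀ s ∈ J d, ∀ t ∈ J e, ∀ c,
      ‖γ e t - γ d s - latticeVec c‖ < ε → d = e ∧ c = 0 := by
    have e1 := eventually_all.2 fun d => eventually_all.2 fun e =>
      eventually_separated ((isCompact_uIcc (a := a e) (b := b e)).image (hγc e))
        ((isCompact_uIcc (a := a d) (b := b d)).image (hγc d))
    obtain ⟨ε, h1, h2⟩ := (e1.and self_mem_nhdsWithin).exists
    refine ⟨ε, h2, ?_⟩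
    intro d hd e he s hs t ht c h
    obtain ⟨_, ⟨t', ht', rfl⟩, _, ⟨s', hs', rfl⟩, h'⟩ :=
      h1 d e c ⟨_, ⟨t, ht, rfl⟩, _, ⟨s, hs, rfl⟩, h⟩
    exact hcc d hd e he s' (hJ d s' hs') t' (hJ e t' ht') c h'
  -- The bound `ε / 4` keeps two tubes of width `2 / N` disjoint; `r / 4` places the grid points of
  -- the truncated ends, already within `r / 2` of the vertices, inside the neighbourhoods.
  obtain ⟨n, hn⟩ := exists_nat_one_div_lt (lt_min (show 0 < r / 4 by positivity)
    (show 0 < ε / 4 by positivity))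
  obtain ⟨N, hN, hNr, hNε⟩ : ∃ N : ℕ, 0 < N ∧ (1 : ℝ) / N < r / 4 ∧ (1 : ℝ) / N < ε / 4 :=
    ⟨n + 1, Nat.succ_pos n, by push_cast; exact hn.trans_le (min_le_left _ _),
      by push_cast; exact hn.trans_le (min_le_right _ _)⟩
  have h2N : (2 : ℝ) / N = 1 / N + 1 / N := by ring
  have hN0 : (0 : ℝ) < 1 / N := by positivity
  let U : V → Set (ℤ × ℤ) := fun v => {x | ‖gridPoint N x - G.pos v‖ < r}
  let W : D → Set (ℤ × ℤ) := fun d => {x | ∃ z ∈ γ d '' J d, ‖gridPoint N x - z‖ ≤ 2 / N}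
  refine gridModel_of_neighborhoods G N hN shift hdisp ?_ R hR U W ?_ ?_
    (fun v => gridFloor N (G.pos v)) ?_ ?_ ?_ ?_ ?_ ?_ ?_
  · intro d
    simp only [hshift, G.rev_rev]
    abel
  · intro v
    refine (finite_gridPoint_near hN (Bornology.isBounded_singleton (x := G.pos v)) r).subset ?_
    intro x hx
    exact ⟨_, rfl, le_of_lt hx⟩
  · intro d
    exact finite_gridPoint_near hN ((isCompact_uIcc.image (hγc d)).isBounded) _
  · intro v
    exact (norm_gridFloor_sub_le hN _).trans_lt (by linarith)
  · intro v x hx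
    exact box_reachable hN (by linarith) x hx
  · intro v w x c hx hxc
    refine hη1 v w c ?_
    change ‖_‖ < r at hx hxc
    rw [gridPoint_period hN] at hxc
    have e : G.pos w - G.pos v - latticeVec c
        = (gridPoint N x - G.pos v) - (gridPoint N x + latticeVec c - G.pos w) := by abel
    rw [e]
    refine (norm_sub_le _ _).trans_lt ?_
    linarith
  · intro v w x q c hx hxc
    refine hη1 v w c ?_
    change ‖_‖ < r at hx hxc
    rw [gridPoint_period hN] at hxc
    have hst := norm_gridPoint_step (N := N) x q
    have e : G.pos w - G.pos v - latticeVec c = (gridPoint N x - G.pos v)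
        + (gridPoint N (x + step q) - gridPoint N x)
        - (gridPoint N (x + step q) + latticeVec c - G.pos w) := by abel
    rw [e]
    refine (norm_sub_le _ _).trans_lt ?_
    have := norm_add_le (gridPoint N x - G.pos v) (gridPoint N (x + step q) - gridPoint N x)
    linarith
  · rintro d w x c ⟨_, ⟨t, ht, rfl⟩, hx⟩ hxc
    have ht' := hJ d t ht
    refine hη2 d t ⟨ht'.1.le, ht'.2.le⟩ w c ?_
    change ‖_‖ < r at hxc
    rw [gridPoint_period_sub hN] at hxc
    have e : γ d t - G.pos w - latticeVec c
        = (gridPoint N x - latticeVec c - G.pos w) - (gridPoint N x - γ d t) := by abel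
    rw [e]
    refine (norm_sub_le _ _).trans_lt ?_
    linarith
  · rintro d hd e he x c ⟨_, ⟨s, hs, rfl⟩, hx⟩ ⟨_, ⟨t, ht, rfl⟩, hxc⟩
    refine hε d hd e he s hs t ht c ?_
    rw [gridPoint_period hN] at hxc
    have e' : γ e t - γ d s - latticeVec c
        = (gridPoint N x - γ d s) - (gridPoint N x + latticeVec c - γ e t) := by abel
    rw [e']
    refine (norm_sub_le _ _).trans_lt ?_
    linarith
  · intro d
    have f1 := norm_gridFloor_sub_le hN (γ d (a d))
    have f2 := norm_gridFloor_sub_le hN (γ d (b d))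
    refine ⟨gridFloor N (γ d (a d)), gridFloor N (γ d (b d)), ?_, ?_, ?_, ?_⟩
    · change ‖_‖ < r
      rw [← sub_add_sub_cancel _ (γ d (a d))]
      refine (norm_add_le _ _).trans_lt ?_
      linarith [haγ d]
    · change ‖_‖ < r
      rw [gridPoint_period_sub hN, sub_sub, add_comm (latticeVec _),
        ← sub_add_sub_cancel _ (γ d (b d))]
      refine (norm_add_le _ _).trans_lt ?_
      linarith [hbγ d]
    · exact ⟨_, ⟨a d, Set.left_mem_uIcc, rfl⟩, f1.trans (by linarith)⟩
    · exact curve_reachable hN (hγc d) isPreconnected_uIcc Set.left_mem_uIcc Set.right_mem_uIcc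

end TorusGraph

/-! ### Primitive loops and the conclusion -/

namespace TorusGraph

variable {V D : Type*}

lemma homologyClass_sum [Fintype D] (G : TorusGraph V D) {ι : Type*} (s : Finset ι)
    (ω : ι → D → ℝ) :
    G.homologyClass (fun d => ∑ m ∈ s, ω m d) = ∑ m ∈ s, G.homologyClass (ω m) := by
  simp only [homologyClass, Finset.sum_smul]
  rw [Finset.sum_comm, ← Finset.smul_sum]

/-- Contractible loops can be dropped from a flow. -/
lemma GridModel.exists_essential [Fintype D] [DecidableEq V] {G : TorusGraph V D}
    (M : GridModel G) {ω : D → ℝ} (hω : ω ∈ G.unitFlows) :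
    ∃ ω' ∈ G.unitFlows, G.homologyClass ω' = G.homologyClass ω ∧ ∀ d, ω' d ≠ 0 → M.Ess d := by
  classical
  obtain ⟨hf, hcap⟩ := hω
  have hz : ∀ v, ∑ d with G.src d = v, (if M.Ess d then 0 else ω d) = 0 := by
    intro v
    -- Reversal permutes the contractible loops at `v` and changes the sign of `ω`, so their sum is
    -- its own negative.
    have h : ∑ d with G.src d = v, (if M.Ess d then 0 else ω d)
        = -∑ d with G.src d = v, (if M.Ess d then 0 else ω d) := by
      rw [← Finset.sum_neg_distrib, Finset.sum_filter, Finset.sum_filter]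
      nth_rw 1 [← G.sum_comp_rev]
      refine Finset.sum_congr rfl fun d _ => ?_
      by_cases hd : M.Ess d
      · simp [M.ess_rev, hd]
      · have : G.src (G.rev d) = G.src d := by
          by_contra h
          exact hd (Or.inl fun h' => h h'.symm)
        simp [M.ess_rev, hd, this, hf.1]
    linarith
  have hflow : G.IsFlow fun d => if M.Ess d then ω d else 0 := by
    refine ⟨fun d => ?_, fun v => ?_⟩
    · by_cases hd : M.Ess d <;> simp [M.ess_rev, hd, hf.1]
    · have h1 := hf.2 v
      have h2 := hz v
      have h3 : ∑ d with G.src d = v, ω d = ∑ d with G.src d = v, (if M.Ess d then ω d else 0)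
          + ∑ d with G.src d = v, (if M.Ess d then 0 else ω d) := by
        rw [← Finset.sum_add_distrib]
        refine Finset.sum_congr rfl fun d _ => ?_
        split_ifs <;> simp
      linarith
  refine ⟨_, ⟨hflow, fun v => le_trans ?_ (hcap v)⟩, ?_, ?_⟩
  · refine Finset.sum_le_sum fun d _ => ?_
    beta_reduce
    split_ifs
    · exact le_rfl
    · simp
  · rw [homologyClass, homologyClass]
    congr 1
    refine Finset.sum_congr rfl fun d _ => ?_
    split_ifs with hd
    · rfl
    · have h1 : G.src d = G.tgt d := by
        by_contra h
        exact hd (Or.inl h)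
      have h2 : M.shift d = 0 := by
        by_contra h
        exact hd (Or.inr h)
      have : G.displacement d = 0 := by
        rw [M.displacement_eq, h1, h2]
        simp [latticeVec]
      rw [this, smul_zero, smul_zero]
  · intro d hd
    exact (ite_ne_right_iff.1 hd).1

/-- A flow with values in `{0, 1, -1}` and primitive class `(p, q)`, in whose support all cycles
have classes parallel to `(p, q)`, runs along a loop of class `(p, q)`. -/
lemma GridModel.exists_primitive_loop [Fintype V] [Fintype D] [DecidableEq V]
    {G : TorusGraph V D} (M : GridModel G) {p q : ℤ} (hpq : IsCoprime p q) {ω : D → ℝ}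
    (hω : G.IsFlow ω) (hv : ∀ d, ω d = 0 ∨ ω d = 1 ∨ ω d = -1) (h0 : ∀ d, ω d ≠ 0 → M.Ess d)
    (hcl : G.homologyClass ω = ((p : ℝ), (q : ℝ))) {T : V → ℤ} {k : ℕ} (hk : 0 < k)
    (hT : ∀ d, ω d ≠ 0 →
      T (G.src d) - T (G.tgt d) = k * (p * (M.shift d).2 - q * (M.shift d).1)) :
    ∃ L : G.DirectedLoop, (∀ d ∈ L.cycle, ω d = 1) ∧
      G.homologyClass L.flow = ((p : ℝ), (q : ℝ)) := by
  classical
  obtain ⟨u, w, huw⟩ := hpq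
  have huw' : (u : ℝ) * p + w * q = 1 := by exact_mod_cast huw
  have hk0 : (k : ℝ) ≠ 0 := Nat.cast_ne_zero.2 hk.ne'
  have hlin : ∀ f : D → ℝ, ∑ d, f d * (u * (M.shift d).1 + w * (M.shift d).2)
      = u * ∑ d, f d * (M.shift d).1 + w * ∑ d, f d * (M.shift d).2 := by
    intro f
    rw [Finset.mul_sum, Finset.mul_sum, ← Finset.sum_add_distrib]
    exact Finset.sum_congr rfl fun d _ => by ring
  have hcl' := hcl
  rw [M.homologyClass_eq hω, Prod.mk.injEq] at hcl'
  -- The weight is the Bézout functional `(x, y) ↦ u x + w y`, equal to 1 on `(p, q)`. The total is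
  -- 2 because each edge is counted in both orientations.
  obtain ⟨L, hL, hpos⟩ := G.exists_loop_pos
    (fun d => u * (M.shift d).1 + w * (M.shift d).2) hω hv (by
      rw [hlin, show ∑ d, ω d * (M.shift d).1 = 2 * p by linarith,
        show ∑ d, ω d * (M.shift d).2 = 2 * q by linarith]
      linarith)
  refine ⟨L, hL, ?_⟩
  have hLω : ∀ d, L.flow d ≠ 0 → ω d ≠ 0 := by
    intro d hd
    rcases L.mem_of_flow_ne_zero hd with h | h
    · rw [hL d h]; norm_num
    · have := hL _ h
      rw [hω.1] at this
      intro h'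
      rw [h'] at this
      norm_num at this
  have hLf := L.flow_isFlow
  set X := ∑ d, L.flow d * (M.shift d).1 with hX
  set Y := ∑ d, L.flow d * (M.shift d).2 with hY
  -- The loop flow pairs to zero with the gradient of `T`, and on the support this gradient is `-k`
  -- times the determinant of `(p, q)` and the shift.
  have hpar : (p : ℝ) * Y = q * X := by
    have h1 := hLf.sum_smul_sub fun v => (T v : ℝ)
    have h2 : ∑ d, L.flow d • ((T (G.tgt d) : ℝ) - T (G.src d))
        = -(k * (p * Y - q * X)) := by
      rw [hX, hY, Finset.mul_sum, Finset.mul_sum, ← Finset.sum_sub_distrib, Finset.mul_sum,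
        ← Finset.sum_neg_distrib]
      refine Finset.sum_congr rfl fun d _ => ?_
      by_cases hd : L.flow d = 0
      · simp [hd]
      · have h3 := hT d (hLω d hd)
        have h4 : (T (G.src d) : ℝ) - T (G.tgt d)
            = k * (p * (M.shift d).2 - q * (M.shift d).1) := by exact_mod_cast h3
        rw [smul_eq_mul, show (T (G.tgt d) : ℝ) - T (G.src d)
          = -(T (G.src d) - T (G.tgt d)) by ring, h4]
        ring
    rw [h2, neg_eq_zero] at h1
    have := (mul_eq_zero.1 h1).resolve_left hk0
    linarith
  obtain ⟨n, hn⟩ : ∃ n : ℤ, u * X + w * Y = 2 * n := by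
    refine ⟨∑ d with d ∈ L.cycle, (u * (M.shift d).1 + w * (M.shift d).2), ?_⟩
    rw [hX, hY, ← hlin, L.sum_flow_mul]
    · push_cast
      rfl
    · intro d
      rw [M.shift_rev]
      simp
      ring
  rw [hlin, ← hX, ← hY, hn] at hpos
  have hXn : X = 2 * (n * p) := by linear_combination (-X) * huw' + p * hn - w * hpar
  have hYn : Y = 2 * (n * q) := by linear_combination (-Y) * huw' + q * hn + u * hpar
  have hnpos : 0 < n := by
    have : (0 : ℝ) < n := by linarith
    exact_mod_cast this
  obtain ⟨n, rfl⟩ := Int.eq_ofNat_of_zero_le hnpos.le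
  have hn0 : 0 < n := by exact_mod_cast hnpos
  have hLcl : G.homologyClass L.flow = ((n * p : ℝ), (n * q : ℝ)) := by
    rw [M.homologyClass_eq hLf, ← hX, ← hY, hXn, hYn]
    ext <;> simp
  -- The loop has class `n (p, q)`. Rounding its unit flow with `n` levels gives a flow of class
  -- `(p, q)` on the same loop, hence `a` times the unit flow with `a ∈ {0, 1, -1}` and `a n = 1`.
  obtain ⟨η, -, e1, e2, e3, e4, -⟩ := M.exists_rounding hLf
    (fun d hd => h0 d (hLω d hd)) L.inflow_flow_le hn0 p q hLcl
  have hη := L.eq_smul_flow (e1 ⟨0, hn0⟩) (e3 ⟨0, hn0⟩)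
  have hcl2 := e4 ⟨0, hn0⟩
  set a := η ⟨0, hn0⟩ L.start with ha
  have hcl3 : a * n = 1 := by
    have h5 : G.homologyClass (η ⟨0, hn0⟩) = a • G.homologyClass L.flow := by
      simp only [homologyClass]
      rw [smul_comm, Finset.smul_sum (r := a)]
      congr 1
      exact Finset.sum_congr rfl fun d _ => by rw [hη d, mul_smul]
    rw [h5, hLcl, Prod.smul_mk, Prod.mk.injEq, smul_eq_mul, smul_eq_mul] at hcl2
    linear_combination (u : ℝ) * hcl2.1 + w * hcl2.2 + (1 - a * n) * huw'
  have hn1 : (n : ℝ) = 1 := by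
    have hnR : (0 : ℝ) < n := Nat.cast_pos.2 hn0
    rcases e2 ⟨0, hn0⟩ L.start with h | h | h
    · rw [← ha] at h; rw [h] at hcl3; linarith
    · rw [← ha] at h; rw [h] at hcl3; linarith
    · rw [← ha] at h; rw [h] at hcl3; linarith
  rw [hLcl, hn1, one_mul, one_mul]

end TorusGraph

theorem lemma4p1 {V D : Type*} [Fintype V] [Fintype D] [DecidableEq V] (G : TorusGraph V D)
    (i j : ℤ) (hij : ((i : ℝ), (j : ℝ)) ∈ G.unitFlowPolygon) :
    ∃ ω ∈ G.unitFlows,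
      G.homologyClass ω = ((i : ℝ), (j : ℝ)) ∧
      (∀ d, ω d = 0 ∨ ω d = 1 ∨ ω d = -1) ∧
      ∃ C : Set (Cycle D),
        (∀ c ∈ C, G.IsLoop c) ∧
        C.Pairwise G.VertexDisjoint ∧
        (∀ d, ω d = 1 ↔ ∃ c ∈ C, d ∈ c) := by
  classical
  -- The zero class has gcd 0 and no rounding; the zero flow with no loops serves.
  by_cases hz : i = 0 ∧ j = 0
  · obtain ⟨rfl, rfl⟩ := hz
    refine ⟨fun _ => 0, ⟨⟨by simp, by simp⟩, by simp [TorusGraph.inflow]⟩, ?_, by simp, ∅, by simp, by simp,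
      by simp⟩
    simp [TorusGraph.homologyClass, Prod.ext_iff]
  have hgcd : 0 < Int.gcd i j := Int.gcd_pos_iff.2 (by tauto)
  obtain ⟨p, q, hpq, hi, hj⟩ := Int.exists_gcd_one hgcd
  set k := Int.gcd i j with hk
  have hpq' : IsCoprime p q := Int.isCoprime_iff_gcd_eq_one.2 hpq
  have hi' : (i : ℝ) = k * p := by rw [hi]; push_cast; ring
  have hj' : (j : ℝ) = k * q := by rw [hj]; push_cast; ring
  obtain ⟨M⟩ := G.exists_gridModel
  obtain ⟨ω₀, hω₀, hcl₀⟩ := hij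
  obtain ⟨ω, hω, hcl, hess⟩ := M.exists_essential hω₀
  obtain ⟨η, T, e1, e2, e3, e4, e5, e6⟩ := M.exists_rounding hω.1 hess hω.2 hgcd p q
    (by rw [hcl, hcl₀, hi', hj'])
  -- A rounded flow may contain further loops. One of class `(p, q)` is kept from each and the rest
  -- is dropped, so the `k` loops still sum to `(i, j)`.
  choose L hL hLcl using fun m => M.exists_primitive_loop hpq' (e1 m) (e2 m)
    (fun d hd => hess d (e3 m d hd)) (e4 m) hgcd (e6 m)
  have hLη : ∀ m d, (L m).flow d ≠ 0 → η m d ≠ 0 := by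
    intro m d hd
    rcases (L m).mem_of_flow_ne_zero hd with h | h
    · rw [hL m d h]; norm_num
    · have := hL m _ h
      rw [(e1 m).1] at this
      intro h'
      rw [h'] at this
      norm_num at this
  have huniq : ∀ m m' d d', (L m).flow d ≠ 0 → (L m').flow d' ≠ 0 → G.src d = G.src d' → m = m' :=
    fun m m' d d' h h' hs => e5 m m' d d' (hLη m d h) (hLη m' d' h') hs
  have hval : ∀ m d, (L m).flow d ≠ 0 → ∑ m', (L m').flow d = (L m).flow d := by
    intro m d h
    refine Finset.sum_eq_single_of_mem m (Finset.mem_univ _) fun m' _ hne => ?_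
    by_contra h'
    exact hne (huniq m' m d d h' h rfl)
  have hzero : ∀ d, ∑ m, (L m).flow d ≠ 0 → ∃ m, (L m).flow d ≠ 0 := fun d hd =>
    (Finset.exists_ne_zero_of_sum_ne_zero hd).imp fun _ h => h.2
  have hflow : G.IsFlow fun d => ∑ m, (L m).flow d := by
    refine ⟨fun d => ?_, fun v => ?_⟩
    · rw [← Finset.sum_neg_distrib]
      exact Finset.sum_congr rfl fun m _ => (L m).flow_rev d
    · rw [Finset.sum_comm]
      exact Finset.sum_eq_zero fun m _ => (L m).flow_isFlow.2 v
  refine ⟨fun d => ∑ m, (L m).flow d, ⟨hflow, fun v => ?_⟩, ?_, fun d => ?_,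
    Set.range fun m => (L m).cycle, ?_, ?_, fun d => ?_⟩
  · rw [hflow.inflow_eq]
    by_cases hm : ∃ m d, G.src d = v ∧ (L m).flow d ≠ 0
    · obtain ⟨m, d, rfl, hd⟩ := hm
      refine le_trans (le_of_eq ?_) ((L m).inflow_flow_le (G.src d))
      rw [(L m).flow_isFlow.inflow_eq]
      refine Finset.sum_congr rfl fun e he => ?_
      have he' : G.src e = G.src d := (Finset.mem_filter.1 he).2
      congr 1
      refine Finset.sum_eq_single_of_mem m (Finset.mem_univ _) fun m' _ hne => ?_
      by_contra h'
      exact hne (huniq m' m e d h' hd he')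
    · push Not at hm
      refine le_trans (le_of_eq ?_) zero_le_one
      refine Finset.sum_eq_zero fun e he => ?_
      rw [Finset.sum_eq_zero fun m _ => hm m e (Finset.mem_filter.1 he).2, max_self]
  · rw [G.homologyClass_sum, Finset.sum_congr rfl fun m _ => hLcl m, Finset.sum_const,
      Finset.card_univ, Fintype.card_fin, hi', hj']
    simp
  · by_cases h : ∑ m, (L m).flow d = 0
    · exact Or.inl h
    · obtain ⟨m, hm⟩ := hzero d h
      change ∑ m, (L m).flow d = 0 ∨ ∑ m, (L m).flow d = 1 ∨ ∑ m, (L m).flow d = -1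
      rw [hval m d hm]
      exact (L m).flow_cases d
  · rintro _ ⟨m, rfl⟩
    exact (L m).isLoop
  · rintro _ ⟨m, rfl⟩ _ ⟨m', rfl⟩ hne d hd d' hd' hs
    apply hne
    rw [huniq m m' d d' (by rw [(L m).flow_of_mem hd]; norm_num)
      (by rw [(L m').flow_of_mem hd']; norm_num) hs]
  · constructor
    · intro h
      change ∑ m, (L m).flow d = 1 at h
      obtain ⟨m, hm⟩ := hzero d (by rw [h]; norm_num)
      rw [hval m d hm] at h
      exact ⟨_, ⟨m, rfl⟩, (L m).flow_eq_one_iff.1 h⟩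
    · rintro ⟨_, ⟨m, rfl⟩, hd⟩
      have h1 := (L m).flow_of_mem hd
      change ∑ m, (L m).flow d = 1
      rw [hval m d (by rw [h1]; norm_num), h1]
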